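/- **Heavy-tailed operator norm resilience.** There are absolute constants $C_0, C > 0$ such that the following holds. *Setting.* Let $d \ge 1$, let $k \ge 4$ be real, $M = m_k \ge 0$, $b = b_{\mathsf{clip}} > 0$ and $\delta \in (0,1)$. Let $P$ be a probability distribution on $\mathbb{R}^d$ with finite second moments, let $\Sigma = \mathbb{E}_{Z\sim P}[ZZ^T]$ (possibly singular), and write $\|z\|_\Sigma = \|\Sigma^{\dagger/2} z\|_2$, where $\Sigma^{\dagger/2}$ is the square root of the pseudo-inverse of $\Sigma$. Assume that $\big(\mathbb{E}|v^T\Sigma^{\dagger/2}Z|^k\big)^{1/k} \le m_k$ for every unit vector $v$, and that the clipping level is large enough for clipping to be rare, in the sense that $$m_k^2\,\mathbb{P}\big(\|Z\|_\Sigma > b_{\mathsf{clip}}\big)^{1-2/k} \le \tfrac13 .$$ Let $Z_1,\dots,Z_n$ be i.i.d. from $P$, and let $\bar Z_i$ be $Z_i$ clipped at level $b_{\mathsf{clip}}$: $\bar Z_i = \mathrm{clip}(Z_i)$ for a measurable map $\mathrm{clip}$ with $\mathrm{clip}(z) = z$ if $\|z\|_\Sigma \le b_{\mathsf{clip}}$,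 and otherwise $\mathrm{clip}(z) = tz$ for some $t = t(z) \in [0,1]$ with $\|\mathrm{clip}(z)\|_\Sigma \le b_{\mathsf{clip}}$ (for example $\min\{1, b_{\mathsf{clip}}/\|z\|_\Sigma\}\,z$ or $z\,\mathbf{1}\{\|z\|_\Sigma \le b_{\mathsf{clip}}\}$). *Resilience.* For $I \subseteq [n]$ put $\Sigma_I = \frac1n \sum_{i\in I} \bar Z_i\bar Z_i^T$. Let $\mathtt{H}_1$ be the first $\lfloor n/2\rfloor$ indices and $\mathtt{H}_2 = [n]\setminus \mathtt{H}_1$. The sample $\bar{\mathcal{Z}} = (\bar Z_1,\dots,\bar Z_n)$ is $(m,\alpha)$-operator norm resilient if for both $H \in \{\mathtt{H}_1,\mathtt{H}_2\}$ one has $\Sigma_H \preceq \frac34 \Sigma_{[n]}$, and $\Sigma_T \preceq \alpha\,\Sigma_H$ for every $T \subseteq H$ with $|T| \le m$. *Claim.* If $n \ge C_0\, b_{\mathsf{clip}}^2 \log(2d/\delta)$ and $m_{\mathsf{op}} \le n$, then with probability at least $1-4\delta$ the sample $\bar{\mathcal{Z}}$ is $(m_{\mathsf{op}}, \alpha_{\mathsf{op}})$-operator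 norm resilient with $$\alpha_{\mathsf{op}} = C\left(\sqrt{\frac{b_{\mathsf{clip}}^2\log(d/\delta)}{n}} + m_k^2\sqrt{\frac{d+\log(1/\delta)}{n}} + m_k^2\left(\frac{\max\{m_{\mathsf{op}},\, d+\log(1/\delta)\}}{n}\right)^{1-\frac2k}\right).$$ -/

import Mathlib

open MeasureTheory ProbabilityTheory

noncomputable section

namespace HeavyTail

/-- `ℝ^d` with the Euclidean norm. -/
abbrev E (d : ℕ) : Type := EuclideanSpace ℝ (Fin d)

/-- The matrix `𝔼[Z Zᵀ]` for `Z ∼ P`. -/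
def secondMoment {d : ℕ} (P : Measure (E d)) : Matrix (Fin d) (Fin d) ℝ :=
  Matrix.of fun i j => ∫ z, z i * z j ∂P

/-- `S^{†/2}`, the square root of the Moore–Penrose pseudo-inverse of a positive semidefinite
matrix `S`: it has the eigenvectors of `S`, a positive eigenvalue `x` becomes `1 / √x`, and the
eigenvalue `0` stays `0` (in Lean `(√0)⁻¹ = 0`). -/
def pinvSqrt {d : ℕ} (S : Matrix (Fin d) (Fin d) ℝ) : Matrix (Fin d) (Fin d) ℝ :=
  cfc (fun x : ℝ => (√x)⁻¹) S

/-- The whitened vector `S^{†/2} z`. -/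
def whiten {d : ℕ} (S : Matrix (Fin d) (Fin d) ℝ) (z : E d) : E d :=
  WithLp.toLp 2 (Matrix.mulVec (pinvSqrt S) z.ofLp)

/-- `‖z‖_S = ‖S^{†/2} z‖`. -/
def mnorm {d : ℕ} (S : Matrix (Fin d) (Fin d) ℝ) (z : E d) : ℝ := ‖whiten S z‖

/-- `(𝔼 |⟨v, S^{†/2} Z⟩|^k)^{1/k} ≤ M` for every unit vector `v`, where `S = 𝔼[Z Zᵀ]`, `Z ∼ P`. -/
def MomentBound {d : ℕ} (P : Measure (E d)) (k M : ℝ) : Prop :=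
  ∀ v : E d, ‖v‖ = 1 →
    eLpNorm (fun z => inner ℝ v (whiten (secondMoment P) z)) (ENNReal.ofReal k) P
      ≤ ENNReal.ofReal M

/-- `clip` is a clipping map at level `b` for `‖·‖_S`: vectors of norm at most `b` are kept, all
others are shrunk towards the origin to norm at most `b`. Radial projection (`radialClip`) and
replacement by `0` (`zeroClip`) are the two usual choices. -/
def IsClipping {d : ℕ} (S : Matrix (Fin d) (Fin d) ℝ) (b : ℝ) (clip : E d → E d) : Prop :=
  Measurable clip ∧
  (∀ z, mnorm S z ≤ b → clip z = z) ∧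
  (∀ z, b < mnorm S z → ∃ t : ℝ, 0 ≤ t ∧ t ≤ 1 ∧ clip z = t • z ∧ mnorm S (clip z) ≤ b)

/-- `z ↦ min {1, b / ‖z‖_S} z`. -/
def radialClip {d : ℕ} (S : Matrix (Fin d) (Fin d) ℝ) (b : ℝ) (z : E d) : E d :=
  if mnorm S z ≤ b then z else (b / mnorm S z) • z

/-- `z ↦ z 1{‖z‖_S ≤ b}`. -/
def zeroClip {d : ℕ} (S : Matrix (Fin d) (Fin d) ℝ) (b : ℝ) (z : E d) : E d :=
  if mnorm S z ≤ b then z else 0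

lemma mnorm_smul {d : ℕ} (S : Matrix (Fin d) (Fin d) ℝ) (t : ℝ) (z : E d) :
    mnorm S (t • z) = |t| * mnorm S z := by
  simp [mnorm, whiten, Matrix.mulVec_smul, norm_smul]

lemma continuous_mnorm {d : ℕ} (S : Matrix (Fin d) (Fin d) ℝ) : Continuous (mnorm S) := by
  unfold mnorm whiten
  fun_prop

lemma isClipping_radialClip {d : ℕ} (S : Matrix (Fin d) (Fin d) ℝ) {b : ℝ} (hb : 0 ≤ b) :
    IsClipping S b (radialClip S b) := by
  have hm := (continuous_mnorm S).measurable
  refine ⟨?_, fun z hz => by simp [radialClip, hz], fun z hz => ?_⟩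
  · exact Measurable.ite (measurableSet_le hm measurable_const) measurable_id
      ((measurable_const.div hm).smul measurable_id)
  · have h0 : 0 < mnorm S z := lt_of_le_of_lt hb hz
    have he : radialClip S b z = (b / mnorm S z) • z := by simp [radialClip, not_le.2 hz]
    refine ⟨b / mnorm S z, by positivity, (div_le_one h0).2 hz.le, he, ?_⟩
    rw [he, mnorm_smul, abs_of_nonneg (by positivity), div_mul_cancel₀ _ h0.ne']

lemma isClipping_zeroClip {d : ℕ} (S : Matrix (Fin d) (Fin d) ℝ) {b : ℝ} (hb : 0 ≤ b) :
    IsClipping S b (zeroClip S b) := by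
  have hm := (continuous_mnorm S).measurable
  refine ⟨?_, fun z hz => by simp [zeroClip, hz], fun z hz => ?_⟩
  · exact Measurable.ite (measurableSet_le hm measurable_const) measurable_id measurable_const
  · have he : zeroClip S b z = 0 := by simp [zeroClip, not_le.2 hz]
    refine ⟨0, le_rfl, zero_le_one, by simp [he], ?_⟩
    rw [he]
    simpa [mnorm, whiten] using hb

/-- `(1/n) ∑_{i ∈ I} z_i z_iᵀ`; the normalization is by the full sample size `n` for every `I`. -/
def scov {n d : ℕ} (z : Fin n → E d) (I : Finset (Fin n)) : Matrix (Fin d) (Fin d) ℝ :=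
  (1 / (n : ℝ)) • ∑ i ∈ I, Matrix.vecMulVec (z i).ofLp (z i).ofLp

/-- The first half of the indices. -/
def half₁ (n : ℕ) : Finset (Fin n) := Finset.univ.filter fun i => (i : ℕ) < n / 2

/-- The second half of the indices. -/
def half₂ (n : ℕ) : Finset (Fin n) := (half₁ n)ᶜ

/-- `(m, α)`-operator norm resilience: in the Loewner order, for either half `H`, the covariance
of `H` is at most `3/4` of the full one, and any at most `m` indices of `H` contribute at most
`α` times the covariance of `H`. -/
def OpNormResilient {n d : ℕ} (z : Fin n → E d) (m : ℕ) (α : ℝ) : Prop :=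
  ∀ H : Finset (Fin n), H = half₁ n ∨ H = half₂ n →
    ((3 / 4 : ℝ) • scov z Finset.univ - scov z H).PosSemidef ∧
    ∀ T : Finset (Fin n), T ⊆ H → T.card ≤ m → (α • scov z H - scov z T).PosSemidef

/-- The rate
`√(b² log(d/δ)/n) + M² √((d + log(1/δ))/n) + M² (max{m, d + log(1/δ)}/n)^{1 - 2/k}`. -/
def rate (d n m : ℕ) (k M b δ : ℝ) : ℝ :=
  √(b ^ 2 * Real.log (d / δ) / n)
    + M ^ 2 * √((d + Real.log (1 / δ)) / n)
    + M ^ 2 * (max (m : ℝ) (d + Real.log (1 / δ)) / n) ^ (1 - 2 / k)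

end HeavyTail

end

noncomputable section

namespace HeavyTail

open NormedSpace Matrix

variable {ι : Type*} [Fintype ι] [DecidableEq ι]

/-! ### Trace inequalities for the matrix exponential -/

/-! Whitening turns the Loewner inequalities into inequalities between sums of `⟪v, Y i⟫²`, where `Y
i` is the whitened clipped sample, bounded by `b`, and `v` ranges over the image of `Σ^{1/2}`. In
those directions the whitened vector is isotropic and rare clipping removes at most a third of its
second moment, so `q = 𝔼⟪v, Y⟫²` lies in `[2/3, 1]` for unit `v`.

No union bound over the subsets `T` is needed. For nonnegative `x i = ⟪v, Y i⟫²` and any level `τ`,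
`∑_T x ≤ ∑ x - ∑ min x τ + |T| τ` (`sum_add_sum_min_le`). It suffices to bound the full sum from
above and the truncated sum from below, uniformly in `v`; the leading terms `n q` cancel.

The full sum is controlled by a matrix Chernoff bound (`measure_sum_sq_gt_le`), with error of order
`√(b² log(d/δ)/n)`. Applied to both tails on both halves, it also compares the halves and gives the
factor `3/4`. It is proved by adding one sample at a time: Klein's inequality and a trapezoidal
trace inequality control a rank one change of the exponent.

The truncated sum is controlled by a PAC-Bayes argument (`measure_sum_min_lt_le`): directions are
smoothed over a unit ball around `v`, and comparison with the ball of radius `2` around `0` costs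
only a factor `2^d`. This uses fourth and `k`-th moments and pays `d + log(1/δ)`. The choice `τ = 4
M² x^(-2/k)`, `x = max{m, d + log(1/δ)}/n`, balances the truncation bias against `|T| τ / n`
(`sum_subset_le_rate_mul`). -/

lemma exists_diagonalization {X : Matrix ι ι ℝ} (hX : X.IsHermitian) :
    ∃ (U : Matrix ι ι ℝ) (x : ι → ℝ), U * Uᵀ = 1 ∧ Uᵀ * U = 1 ∧ X = U * diagonal x * Uᵀ ∧
      exp X = U * diagonal (fun i => Real.exp (x i)) * Uᵀ := by
  have h1 : (hX.eigenvectorUnitary : Matrix ι ι ℝ) * (hX.eigenvectorUnitary : Matrix ι ι ℝ)ᵀ = 1 := by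
    have := Unitary.coe_mul_star_self hX.eigenvectorUnitary
    simpa [star_eq_conjTranspose, conjTranspose_eq_transpose_of_trivial] using this
  have h2 : (hX.eigenvectorUnitary : Matrix ι ι ℝ)ᵀ * (hX.eigenvectorUnitary : Matrix ι ι ℝ) = 1 := by
    have := Unitary.coe_star_mul_self hX.eigenvectorUnitary
    simpa [star_eq_conjTranspose, conjTranspose_eq_transpose_of_trivial] using this
  have h3 : X = (hX.eigenvectorUnitary : Matrix ι ι ℝ) * diagonal hX.eigenvalues *
      (hX.eigenvectorUnitary : Matrix ι ι ℝ)ᵀ := by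
    have := hX.spectral_theorem
    rw [Unitary.conjStarAlgAut_apply] at this
    simpa [star_eq_conjTranspose, conjTranspose_eq_transpose_of_trivial, Function.comp_def] using this
  refine ⟨hX.eigenvectorUnitary, hX.eigenvalues, h1, h2, h3, ?_⟩
  have hi : (hX.eigenvectorUnitary : Matrix ι ι ℝ)⁻¹ = (hX.eigenvectorUnitary : Matrix ι ι ℝ)ᵀ :=
    inv_eq_right_inv h1
  have hu : IsUnit (hX.eigenvectorUnitary : Matrix ι ι ℝ) := ⟨⟨_, _, h1, h2⟩, rfl⟩
  have := exp_conj (hX.eigenvectorUnitary : Matrix ι ι ℝ) (diagonal hX.eigenvalues) hu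
  rw [hi, ← h3, exp_diagonal] at this
  rw [this]
  congr 3
  ext i
  rw [Pi.coe_exp, Real.exp_eq_exp_ℝ]

/-- The weights are squares and do not depend on `a`, `b`. A scalar inequality in the pairs of
eigenvalues therefore lifts to a trace inequality for two non-commuting matrices. -/
lemma trace_conj_diagonal_mul (U V : Matrix ι ι ℝ) (a b : ι → ℝ) :
    trace (U * diagonal a * Uᵀ * (V * diagonal b * Vᵀ)) =
      ∑ i, ∑ j, (a i * b j) * (Uᵀ * V) i j ^ 2 := by
  have : trace (U * diagonal a * Uᵀ * (V * diagonal b * Vᵀ)) =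
      trace (diagonal a * (Uᵀ * V) * (diagonal b * (Uᵀ * V)ᵀ)) := by
    rw [transpose_mul, transpose_transpose]
    simp only [Matrix.mul_assoc]
    rw [Matrix.trace_mul_comm]
    simp only [Matrix.mul_assoc]
  rw [this]
  simp only [trace, diag_apply]
  refine Finset.sum_congr rfl fun i _ => ?_
  rw [mul_apply]
  refine Finset.sum_congr rfl fun j _ => ?_
  rw [diagonal_mul, diagonal_mul, transpose_apply]
  ring

/-- The trapezoidal rule overestimates the integral of the convex function `exp`: the logarithmic
mean of `e^x` and `e^y` is at most their arithmetic mean. -/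
lemma sub_mul_exp_sub_exp_le (x y : ℝ) :
    (x - y) * (Real.exp x - Real.exp y) ≤ (x - y) ^ 2 * (Real.exp x + Real.exp y) / 2 := by
  have key : ∀ h : ℝ, 0 ≤ h → Real.exp h - 1 ≤ h / 2 * (Real.exp h + 1) := by
    intro h hh
    have hmono : MonotoneOn (fun h : ℝ => h / 2 * (Real.exp h + 1) - Real.exp h) (Set.Ici 0) := by
      refine monotoneOn_of_deriv_nonneg (convex_Ici 0) (by fun_prop) (by fun_prop) fun t _ => ?_
      have hd : HasDerivAt (fun h : ℝ => h / 2 * (Real.exp h + 1) - Real.exp h)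
          (1 / 2 * (Real.exp t + 1) + t / 2 * Real.exp t - Real.exp t) t :=
        (((hasDerivAt_id t).div_const 2).mul ((Real.hasDerivAt_exp t).add_const 1)).sub
          (Real.hasDerivAt_exp t)
      rw [hd.deriv]
      have h1 := Real.add_one_le_exp (-t)
      have h2 : Real.exp (-t) * Real.exp t = 1 := by rw [← Real.exp_add]; simp
      nlinarith [mul_le_mul_of_nonneg_right h1 (Real.exp_pos t).le]
    have := hmono (Set.mem_Ici.2 le_rfl) (Set.mem_Ici.2 hh) hh
    simp only [Real.exp_zero] at this
    linarith
  wlog hxy : y ≤ x generalizing x y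
  · have := this y x (not_le.1 hxy).le
    nlinarith
  have h1 := key (x - y) (by linarith)
  have h2 : Real.exp x = Real.exp (x - y) * Real.exp y := by rw [← Real.exp_add]; ring_nf
  rw [h2]
  have h3 : 0 ≤ (x - y) * Real.exp y := mul_nonneg (by linarith) (Real.exp_pos y).le
  nlinarith [mul_le_mul_of_nonneg_left h1 h3]

/-- Klein's inequality for the exponential. -/
lemma trace_exp_le_add {X Y : Matrix ι ι ℝ} (hX : X.IsHermitian) (hY : Y.IsHermitian) :
    trace (exp X) ≤ trace (exp Y) + trace ((X - Y) * exp X) := by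
  obtain ⟨U, x, hU1, hU2, hX1, hX2⟩ := exists_diagonalization hX
  obtain ⟨V, y, hV1, hV2, hY1, hY2⟩ := exists_diagonalization hY
  have eU : (1 : Matrix ι ι ℝ) = U * diagonal (fun _ => 1) * Uᵀ := by simp [hU1]
  have eV : (1 : Matrix ι ι ℝ) = V * diagonal (fun _ => 1) * Vᵀ := by simp [hV1]
  have t1 : trace (exp X) = ∑ i, ∑ j, (Real.exp (x i) * 1) * (Uᵀ * V) i j ^ 2 := by
    rw [← trace_conj_diagonal_mul, ← hX2, ← eV, mul_one]
  have t2 : trace (exp Y) = ∑ i, ∑ j, (1 * Real.exp (y j)) * (Uᵀ * V) i j ^ 2 := by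
    rw [← trace_conj_diagonal_mul, ← hY2, ← eU, one_mul]
  have t3 : trace (X * exp X) = ∑ i, ∑ j, (x i * Real.exp (x i) * 1) * (Uᵀ * V) i j ^ 2 := by
    rw [← trace_conj_diagonal_mul, ← eV, mul_one, hX2]
    conv_lhs => rw [hX1]
    rw [show U * diagonal x * Uᵀ * (U * diagonal (fun i => Real.exp (x i)) * Uᵀ)
      = U * diagonal x * (Uᵀ * U) * (diagonal (fun i => Real.exp (x i)) * Uᵀ) by
        simp only [Matrix.mul_assoc], hU2, mul_one, ← diagonal_mul_diagonal]
    simp only [Matrix.mul_assoc]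
  have t4 : trace (Y * exp X) = ∑ i, ∑ j, (Real.exp (x i) * y j) * (Uᵀ * V) i j ^ 2 := by
    rw [← trace_conj_diagonal_mul, ← hY1, ← hX2, Matrix.trace_mul_comm]
  rw [Matrix.sub_mul, trace_sub, t1, t2, t3, t4, ← Finset.sum_sub_distrib, ← Finset.sum_add_distrib]
  refine Finset.sum_le_sum fun i _ => ?_
  rw [← Finset.sum_sub_distrib, ← Finset.sum_add_distrib]
  refine Finset.sum_le_sum fun j _ => ?_
  have h1 := Real.add_one_le_exp (y j - x i)
  have h2 : Real.exp (y j) = Real.exp (y j - x i) * Real.exp (x i) := by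
    rw [← Real.exp_add]; ring_nf
  have h3 := mul_le_mul_of_nonneg_right h1 (Real.exp_pos (x i)).le
  rw [← h2] at h3
  nlinarith [mul_nonneg (sub_nonneg.2 h3) (sq_nonneg ((Uᵀ * V) i j))]

/-- All twelve traces in the expansion are sums with the same nonnegative weights, so
`sub_mul_exp_sub_exp_le` applies termwise to the eigenvalues. -/
lemma trace_sub_mul_exp_sub_exp_le {X Y : Matrix ι ι ℝ} (hX : X.IsHermitian)
    (hY : Y.IsHermitian) :
    trace ((X - Y) * (exp X - exp Y)) ≤
      trace ((X - Y) * (X - Y) * (exp X + exp Y)) / 2 := by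
  obtain ⟨U, x, hU1, hU2, hX1, hX2⟩ := exists_diagonalization hX
  obtain ⟨V, y, hV1, hV2, hY1, hY2⟩ := exists_diagonalization hY
  have eU : (1 : Matrix ι ι ℝ) = U * diagonal (fun _ => 1) * Uᵀ := by simp [hU1]
  have eV : (1 : Matrix ι ι ℝ) = V * diagonal (fun _ => 1) * Vᵀ := by simp [hV1]
  have mU : ∀ a b : ι → ℝ, (U * diagonal a * Uᵀ) * (U * diagonal b * Uᵀ) =
      U * diagonal (fun i => a i * b i) * Uᵀ := fun a b => by
    rw [show U * diagonal a * Uᵀ * (U * diagonal b * Uᵀ)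
      = U * diagonal a * (Uᵀ * U) * (diagonal b * Uᵀ) by
        simp only [Matrix.mul_assoc], hU2, mul_one, ← diagonal_mul_diagonal]
    simp only [Matrix.mul_assoc]
  have mV : ∀ a b : ι → ℝ, (V * diagonal a * Vᵀ) * (V * diagonal b * Vᵀ) =
      V * diagonal (fun i => a i * b i) * Vᵀ := fun a b => by
    rw [show V * diagonal a * Vᵀ * (V * diagonal b * Vᵀ)
      = V * diagonal a * (Vᵀ * V) * (diagonal b * Vᵀ) by
        simp only [Matrix.mul_assoc], hV2, mul_one, ← diagonal_mul_diagonal]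
    simp only [Matrix.mul_assoc]
  have gen : ∀ (a b : ι → ℝ), trace (U * diagonal a * Uᵀ * (V * diagonal b * Vᵀ)) =
      ∑ i, ∑ j, (a i * b j) * (Uᵀ * V) i j ^ 2 := trace_conj_diagonal_mul U V
  have a1 : trace (X * exp X) = ∑ i, ∑ j, ((x i * Real.exp (x i)) * 1) * (Uᵀ * V) i j ^ 2 := by
    rw [← gen, ← mU, ← eV, ← hX2, ← hX1, mul_one]
  have a2 : trace (X * exp Y) = ∑ i, ∑ j, (x i * Real.exp (y j)) * (Uᵀ * V) i j ^ 2 := by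
    rw [← gen, ← hX1, ← hY2]
  have a3 : trace (Y * exp X) = ∑ i, ∑ j, (Real.exp (x i) * y j) * (Uᵀ * V) i j ^ 2 := by
    rw [← gen, ← hY1, ← hX2, trace_mul_comm]
  have a4 : trace (Y * exp Y) = ∑ i, ∑ j, (1 * (y j * Real.exp (y j))) * (Uᵀ * V) i j ^ 2 := by
    rw [← gen, ← mV, ← eU, ← hY2, ← hY1, one_mul]
  have b1 : trace (X * X * exp X) =
      ∑ i, ∑ j, ((x i * x i * Real.exp (x i)) * 1) * (Uᵀ * V) i j ^ 2 := by
    rw [← gen, ← mU, ← mU, ← eV, ← hX2, ← hX1, mul_one]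
  have b2 : trace (X * Y * exp X) =
      ∑ i, ∑ j, ((Real.exp (x i) * x i) * y j) * (Uᵀ * V) i j ^ 2 := by
    rw [← gen, ← mU, ← hX2, ← hX1, ← hY1, trace_mul_comm]; simp only [Matrix.mul_assoc]
  have b3 : trace (Y * X * exp X) =
      ∑ i, ∑ j, ((x i * Real.exp (x i)) * y j) * (Uᵀ * V) i j ^ 2 := by
    rw [← gen, ← mU, ← hX2, ← hX1, ← hY1, Matrix.mul_assoc, trace_mul_comm]
  have b4 : trace (Y * Y * exp X) =
      ∑ i, ∑ j, (Real.exp (x i) * (y j * y j)) * (Uᵀ * V) i j ^ 2 := by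
    rw [← gen, ← mV, ← hX2, ← hY1, trace_mul_comm]
  have c1 : trace (X * X * exp Y) =
      ∑ i, ∑ j, ((x i * x i) * Real.exp (y j)) * (Uᵀ * V) i j ^ 2 := by
    rw [← gen, ← mU, ← hX1, ← hY2]
  have c2 : trace (X * Y * exp Y) =
      ∑ i, ∑ j, (x i * (y j * Real.exp (y j))) * (Uᵀ * V) i j ^ 2 := by
    rw [← gen, ← mV, ← hX1, ← hY2, ← hY1, Matrix.mul_assoc]
  have c3 : trace (Y * X * exp Y) =
      ∑ i, ∑ j, (x i * (Real.exp (y j) * y j)) * (Uᵀ * V) i j ^ 2 := by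
    rw [← gen, ← mV, ← hX1, ← hY2, ← hY1, Matrix.mul_assoc, trace_mul_comm, Matrix.mul_assoc]
  have c4 : trace (Y * Y * exp Y) =
      ∑ i, ∑ j, (1 * (y j * y j * Real.exp (y j))) * (Uᵀ * V) i j ^ 2 := by
    rw [← gen, ← mV, ← mV, ← eU, ← hY2, ← hY1, one_mul]
  have l : trace ((X - Y) * (exp X - exp Y)) =
      trace (X * exp X) - trace (X * exp Y) - trace (Y * exp X) + trace (Y * exp Y) := by
    simp only [Matrix.sub_mul, Matrix.mul_sub, trace_sub]; ring
  have r : trace ((X - Y) * (X - Y) * (exp X + exp Y)) =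
      trace (X * X * exp X) - trace (X * Y * exp X) - trace (Y * X * exp X)
        + trace (Y * Y * exp X) + trace (X * X * exp Y) - trace (X * Y * exp Y)
        - trace (Y * X * exp Y) + trace (Y * Y * exp Y) := by
    simp only [Matrix.sub_mul, Matrix.mul_sub, Matrix.mul_add, trace_sub, trace_add]; ring
  rw [l, r, a1, a2, a3, a4, b1, b2, b3, b4, c1, c2, c3, c4]
  simp only [← Finset.sum_sub_distrib, ← Finset.sum_add_distrib, Finset.sum_div]
  refine Finset.sum_le_sum fun i _ => Finset.sum_le_sum fun j _ => ?_
  have h := mul_le_mul_of_nonneg_right (sub_mul_exp_sub_exp_le (x i) (y j))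
    (sq_nonneg ((Uᵀ * V) i j))
  nlinarith [h]

lemma dotProduct_exp_mulVec_nonneg {X : Matrix ι ι ℝ} (hX : X.IsHermitian) (v : ι → ℝ) :
    0 ≤ v ⬝ᵥ (exp X *ᵥ v) := by
  obtain ⟨U, x, hU1, hU2, hX1, hX2⟩ := exists_diagonalization hX
  rw [hX2, ← mulVec_mulVec, ← mulVec_mulVec, dotProduct_mulVec, ← mulVec_transpose]
  simp only [dotProduct, mulVec_diagonal]
  refine Finset.sum_nonneg fun i _ => ?_
  nlinarith [mul_nonneg (Real.exp_pos (x i)).le (sq_nonneg ((Uᵀ *ᵥ v) i))]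

/-- Each `e^{x i}` is one of the positive summands of the trace, so every eigenvalue is at most `log
K`. -/
lemma dotProduct_mulVec_le_log_mul {X : Matrix ι ι ℝ} (hX : X.IsHermitian) {K : ℝ}
    (hK : trace (exp X) ≤ K) (v : ι → ℝ) : v ⬝ᵥ (X *ᵥ v) ≤ Real.log K * (v ⬝ᵥ v) := by
  obtain ⟨U, x, hU1, hU2, hX1, hX2⟩ := exists_diagonalization hX
  have h1 : trace (exp X) = ∑ i, Real.exp (x i) := by
    rw [hX2, trace_mul_comm, ← Matrix.mul_assoc, hU2, one_mul, trace_diagonal]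
  have h2 : v ⬝ᵥ v = (Uᵀ *ᵥ v) ⬝ᵥ (Uᵀ *ᵥ v) := by
    rw [dotProduct_mulVec, vecMul_transpose, mulVec_mulVec, hU1, one_mulVec]
  rw [h2]
  conv_lhs => rw [hX1, ← mulVec_mulVec, ← mulVec_mulVec, dotProduct_mulVec, ← mulVec_transpose]
  simp only [dotProduct, mulVec_diagonal, Finset.mul_sum]
  refine Finset.sum_le_sum fun i _ => ?_
  have h3 : x i ≤ Real.log K := by
    have h4 : Real.exp (x i) ≤ K := (Finset.single_le_sum (f := fun i => Real.exp (x i))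
      (fun j _ => (Real.exp_pos _).le) (Finset.mem_univ i)).trans (h1 ▸ hK)
    exact (Real.le_log_iff_exp_le ((Real.exp_pos _).trans_le h4)).2 h4
  nlinarith [mul_nonneg (sub_nonneg.2 h3) (sq_nonneg ((Uᵀ *ᵥ v) i))]

lemma trace_vecMulVec_mul {κ : Type*} [Fintype κ] (v : κ → ℝ) (A : Matrix κ κ ℝ) :
    trace (vecMulVec v v * A) = v ⬝ᵥ (A *ᵥ v) := by
  rw [vecMulVec_mul, trace_vecMulVec, dotProduct_mulVec, dotProduct_comm]

/-- Adding a small rank one matrix `t v vᵀ` to the exponent changes the trace exponential at most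
like its linearization, up to the factor `(1 + t r / 2) / (1 - t r / 2)`. -/
lemma trace_exp_add_rankOne_le {W : Matrix ι ι ℝ} (hW : W.IsHermitian) (v : ι → ℝ) {t r : ℝ}
    (hv : v ⬝ᵥ v ≤ r) (htr : |t| * r < 2) :
    trace (exp (W + t • vecMulVec v v)) ≤
      trace (exp W) + (1 + t * r / 2) / (1 - t * r / 2) * (t * (v ⬝ᵥ (exp W *ᵥ v))) := by
  have hB : (t • vecMulVec v v).IsHermitian := by
    ext i j; simp [vecMulVec_apply, mul_comm]
  have hX := hW.add hB
  set X := W + t • vecMulVec v v with hXd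
  have hsub : X - W = t • vecMulVec v v := by simp [hXd]
  have k := trace_exp_le_add hX hW
  have m := trace_sub_mul_exp_sub_exp_le hX hW
  have hp := dotProduct_exp_mulVec_nonneg hX v
  have hq := dotProduct_exp_mulVec_nonneg hW v
  -- Since `v vᵀ` squares to a multiple of itself, both trace inequalities become scalar relations
  -- between the quadratic forms `p` and `q`.
  have hvv : vecMulVec v v * vecMulVec v v = (v ⬝ᵥ v) • vecMulVec v v := by
    rw [vecMulVec_mul_vecMulVec, vecMulVec_smul]
  rw [hsub] at k m
  simp only [Matrix.smul_mul, Matrix.mul_smul, hvv, trace_smul, Matrix.mul_sub, Matrix.mul_add,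
    trace_sub, trace_add, trace_vecMulVec_mul, smul_eq_mul] at k m
  set p := v ⬝ᵥ (exp X *ᵥ v)
  set q := v ⬝ᵥ (exp W *ᵥ v)
  have hr : 0 ≤ r := le_trans (by simpa using dotProduct_star_self_nonneg v) hv
  have habs := abs_mul t r
  rw [abs_of_nonneg hr] at habs
  have hlt : t * r < 2 := (le_abs_self _).trans_lt (by rw [habs]; exact htr)
  have hden : 0 < 1 - t * r / 2 := by linarith
  have hm : t * (p - q) ≤ t ^ 2 * r * (p + q) / 2 := by
    have : t ^ 2 * (v ⬝ᵥ v) * (p + q) ≤ t ^ 2 * r * (p + q) :=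
      mul_le_mul_of_nonneg_right (mul_le_mul_of_nonneg_left hv (sq_nonneg t)) (by linarith)
    nlinarith
  -- `hm` rearranges to `t p (1 - t r/2) ≤ t q (1 + t r/2)`, for either sign of `t`.
  have : t * p ≤ (1 + t * r / 2) / (1 - t * r / 2) * (t * q) := by
    rw [div_mul_eq_mul_div, le_div_iff₀ hden]
    nlinarith
  linarith

end HeavyTail

namespace HeavyTail

open NormedSpace Matrix

/-! ### Matrix Chernoff bound for sums of bounded rank one matrices -/

section Chernoff

open scoped Matrix.Norms.Operator in
lemma continuous_matrix_exp (d : ℕ) :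
    Continuous (exp : Matrix (Fin d) (Fin d) ℝ → Matrix (Fin d) (Fin d) ℝ) :=
  exp_continuous

lemma continuous_vecMulVec_self {ι : Type*} {d : ℕ} (i : ι) :
    Continuous fun y : ι → E d => vecMulVec (y i).ofLp (y i).ofLp := by
  have h : Continuous fun y : ι → E d => (y i).ofLp := by fun_prop
  exact h.matrix_vecMulVec h

variable {n d : ℕ} {Ω : Type*} [MeasurableSpace Ω] {μ : Measure Ω} [IsProbabilityMeasure μ]
  {ν : Measure (E d)} {Y : Fin n → Ω → E d} {b : ℝ}

lemma integrable_comp_of_bounded {ι : Type*} [Fintype ι] {Y : ι → Ω → E d}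
    (hYm : ∀ i, Measurable (Y i)) (hYb : ∀ i ω, ‖Y i ω‖ ≤ b)
    {f : (ι → E d) → ℝ} (hf : Continuous f) : Integrable (fun ω => f fun i => Y i ω) μ := by
  have hK : IsCompact (Set.univ.pi fun _ : ι => Metric.closedBall (0 : E d) b) :=
    isCompact_univ_pi fun _ => isCompact_closedBall 0 b
  obtain ⟨C, hC⟩ := hK.exists_bound_of_continuousOn hf.continuousOn
  refine Integrable.of_bound (C := C) ?_ (.of_forall fun ω => hC _ fun i _ => by simpa using hYb i ω)
  exact (hf.measurable.comp (measurable_pi_lambda _ hYm)).aestronglyMeasurable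

lemma isHermitian_secondMoment (ν : Measure (E d)) : (secondMoment ν).IsHermitian := by
  ext i j
  simp [secondMoment, mul_comm]

/-- The trace exponential moment behind the matrix Chernoff bound, for both tails at once. -/
lemma integral_trace_exp_sum_le (hYm : ∀ i, Measurable (Y i)) (hYν : ∀ i, μ.map (Y i) = ν)
    (hind : iIndepFun Y μ) (hYb : ∀ i ω, ‖Y i ω‖ ≤ b) {t : ℝ} (ht : |t| * b ^ 2 < 2)
    (s : Finset (Fin n)) :
    ∫ ω, trace (exp (∑ i ∈ s, t • vecMulVec (Y i ω).ofLp (Y i ω).ofLp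
      - ((s.card : ℝ) * ((1 + t * b ^ 2 / 2) / (1 - t * b ^ 2 / 2) * t)) • secondMoment ν)) ∂μ ≤ (d : ℝ) := by
  set κ := (1 + t * b ^ 2 / 2) / (1 - t * b ^ 2 / 2) with hκ
  set Q := secondMoment ν with hQ
  have hQh : Q.IsHermitian := isHermitian_secondMoment ν
  have hexp := continuous_matrix_exp d
  induction s using Finset.induction_on with
  | empty => simp
  | insert j s hj ih =>
    set c := ((insert j s).card : ℝ) * (κ * t) with hc
    -- `W` already carries the compensator for `insert j s` but only the samples in `s`, so it is
    -- independent of `Y j`.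
    set W : (Fin n → E d) → Matrix (Fin d) (Fin d) ℝ :=
      fun y => ∑ i ∈ s, t • vecMulVec (y i).ofLp (y i).ofLp - c • Q with hW
    have hWc : Continuous W := by
      simp only [hW]
      refine Continuous.sub (continuous_finsetSum _ fun i _ => ?_) continuous_const
      exact (continuous_vecMulVec_self _).const_smul t
    have hWh : ∀ y, (W y).IsHermitian := fun y => by
      ext a e
      simp [hW, Matrix.sum_apply, vecMulVec_apply, mul_comm, ← hQh.apply a e]
    have hsum : ∀ y : Fin n → E d, ∑ i ∈ insert j s, t • vecMulVec (y i).ofLp (y i).ofLp - c • Q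
        = W y + t • vecMulVec (y j).ofLp (y j).ofLp := fun y => by
      rw [Finset.sum_insert hj]; simp only [hW]; abel
    have hentry : ∀ a e, Continuous fun y => exp (W y) a e := fun a e =>
      (hexp.comp hWc).matrix_elem a e
    have htrc : ∀ {f : (Fin n → E d) → Matrix (Fin d) (Fin d) ℝ}, Continuous f →
        Continuous fun y => trace (f y) := fun hf => hf.matrix_trace
    have hindep : ∀ a e, ∫ ω, (Y j ω a * Y j ω e) * exp (W fun i => Y i ω) e a ∂μ
        = Q a e * ∫ ω, exp (W fun i => Y i ω) e a ∂μ := by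
      intro a e
      have h0 := hind.indepFun_finset s {j} (Finset.disjoint_singleton_right.2 hj) hYm
      set g : (s → E d) → ℝ := fun y =>
        exp (∑ i : s, t • vecMulVec (y i).ofLp (y i).ofLp - c • Q) e a with hg
      have hgc : Continuous g := by
        refine (hexp.comp ?_).matrix_elem e a
        refine Continuous.sub (continuous_finsetSum _ fun i _ => ?_) continuous_const
        exact (continuous_vecMulVec_self _).const_smul t
      set f : (({j} : Finset (Fin n)) → E d) → ℝ := fun y =>
        y ⟨j, Finset.mem_singleton_self j⟩ a * y ⟨j, Finset.mem_singleton_self j⟩ e with hf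
      have hfc : Continuous f := by simp only [hf]; fun_prop
      have h1 := (h0.comp hgc.measurable hfc.measurable).symm
      have h2 := h1.integral_fun_mul_eq_mul_integral
        (hfc.measurable.comp (measurable_pi_lambda _ fun i => hYm i)).aestronglyMeasurable
        (hgc.measurable.comp (measurable_pi_lambda _ fun i => hYm i)).aestronglyMeasurable
      have h3 : ∀ ω, g (fun i : s => Y i ω) = exp (W fun i => Y i ω) e a := fun ω => by
        simp only [hg, hW]
        rw [Finset.sum_coe_sort s fun i => t • vecMulVec (Y i ω).ofLp (Y i ω).ofLp]
      have h4 : ∫ ω, Y j ω a * Y j ω e ∂μ = Q a e := by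
        simp only [hQ, secondMoment, of_apply]
        rw [← hYν j, integral_map (hYm j).aemeasurable]
        exact Continuous.aestronglyMeasurable (by fun_prop)
      simp only [Function.comp_def, h3, hf] at h2
      rw [h2, h4]
    have hquad : ∫ ω, (Y j ω).ofLp ⬝ᵥ (exp (W fun i => Y i ω) *ᵥ (Y j ω).ofLp) ∂μ =
        ∫ ω, trace (Q * exp (W fun i => Y i ω)) ∂μ := by
      have e1 : ∀ ω, (Y j ω).ofLp ⬝ᵥ (exp (W fun i => Y i ω) *ᵥ (Y j ω).ofLp) =
          ∑ a, ∑ e, (Y j ω a * Y j ω e) * exp (W fun i => Y i ω) e a := fun ω => by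
        rw [← trace_vecMulVec_mul]
        simp [trace, mul_apply, vecMulVec_apply]
      have e2 : ∀ ω, trace (Q * exp (W fun i => Y i ω)) =
          ∑ a, ∑ e, Q a e * exp (W fun i => Y i ω) e a := fun ω => by
        simp [trace, mul_apply]
      simp only [e1, e2]
      have i1 : ∀ a e, Integrable
          (fun ω => (Y j ω a * Y j ω e) * exp (W fun i => Y i ω) e a) μ := fun a e =>
        integrable_comp_of_bounded hYm hYb
          (f := fun y => (y j a * y j e) * exp (W y) e a)
          (Continuous.mul (by fun_prop) (hentry e a))
      have i2 : ∀ a e, Integrable (fun ω => Q a e * exp (W fun i => Y i ω) e a) μ := fun a e =>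
        integrable_comp_of_bounded hYm hYb (f := fun y => Q a e * exp (W y) e a)
          (continuous_const.mul (hentry e a))
      rw [integral_finsetSum _ fun a _ => integrable_finsetSum _ fun e _ => i1 a e,
        integral_finsetSum _ fun a _ => integrable_finsetSum _ fun e _ => i2 a e]
      refine Finset.sum_congr rfl fun a _ => ?_
      rw [integral_finsetSum _ fun e _ => i1 a e, integral_finsetSum _ fun e _ => i2 a e]
      refine Finset.sum_congr rfl fun e _ => ?_
      rw [hindep, integral_const_mul]
    have I1 : Integrable (fun ω => trace (exp (W (fun i => Y i ω)
        + t • vecMulVec (Y j ω).ofLp (Y j ω).ofLp))) μ :=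
      integrable_comp_of_bounded hYm hYb
        (f := fun y => trace (exp (W y + t • vecMulVec (y j).ofLp (y j).ofLp)))
        (htrc (hexp.comp (hWc.add ((continuous_vecMulVec_self _).const_smul t))))
    have I2 : Integrable (fun ω => trace (exp (W fun i => Y i ω))) μ :=
      integrable_comp_of_bounded hYm hYb (f := fun y => trace (exp (W y))) (htrc (hexp.comp hWc))
    have I3 : Integrable (fun ω => (Y j ω).ofLp ⬝ᵥ (exp (W fun i => Y i ω) *ᵥ (Y j ω).ofLp)) μ :=
      integrable_comp_of_bounded hYm hYb
        (f := fun y => (y j).ofLp ⬝ᵥ (exp (W y) *ᵥ (y j).ofLp))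
        (Continuous.dotProduct (by fun_prop) ((hexp.comp hWc).matrix_mulVec (by fun_prop)))
    have I4 : Integrable (fun ω => trace (Q * exp (W fun i => Y i ω))) μ :=
      integrable_comp_of_bounded hYm hYb (f := fun y => trace (Q * exp (W y)))
        (htrc (continuous_const.matrix_mul (hexp.comp hWc)))
    have I5 : Integrable (fun ω => trace (exp (W (fun i => Y i ω) + (κ * t) • Q))) μ :=
      integrable_comp_of_bounded hYm hYb (f := fun y => trace (exp (W y + (κ * t) • Q)))
        (htrc (hexp.comp (hWc.add continuous_const)))
    calc ∫ ω, trace (exp (∑ i ∈ insert j s, t • vecMulVec (Y i ω).ofLp (Y i ω).ofLp - c • Q)) ∂μ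
        = ∫ ω, trace (exp (W (fun i => Y i ω) + t • vecMulVec (Y j ω).ofLp (Y j ω).ofLp)) ∂μ := by
          simp only [fun ω => hsum fun i => Y i ω]
      _ ≤ ∫ ω, (trace (exp (W fun i => Y i ω)) + κ * (t *
            ((Y j ω).ofLp ⬝ᵥ (exp (W fun i => Y i ω) *ᵥ (Y j ω).ofLp)))) ∂μ := by
          refine integral_mono I1 (I2.add ((I3.const_mul t).const_mul κ)) fun ω => ?_
          refine trace_exp_add_rankOne_le (hWh _) _ ?_ ht
          have : (Y j ω).ofLp ⬝ᵥ (Y j ω).ofLp = ‖Y j ω‖ ^ 2 := by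
            rw [EuclideanSpace.real_norm_sq_eq]; simp [dotProduct, sq]
          rw [this]
          exact pow_le_pow_left₀ (norm_nonneg _) (hYb j ω) 2
      _ = ∫ ω, (trace (exp (W fun i => Y i ω)) + κ * t *
            trace (Q * exp (W fun i => Y i ω))) ∂μ := by
          rw [integral_add I2 ((I3.const_mul t).const_mul κ), integral_add I2 (I4.const_mul _),
            integral_const_mul, integral_const_mul, integral_const_mul, hquad, mul_assoc]
      -- Klein's inequality read backwards (convexity of `trace ∘ exp`) absorbs the linear term into
      -- the exponent, which then is the compensated exponent for `s`.
      _ ≤ ∫ ω, trace (exp (W (fun i => Y i ω) + (κ * t) • Q)) ∂μ := by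
          refine integral_mono (I2.add (I4.const_mul _)) I5 fun ω => ?_
          have hh : (W (fun i => Y i ω) + (κ * t) • Q).IsHermitian :=
            (hWh _).add (by ext a e; simp [← hQh.apply a e])
          have := trace_exp_le_add (hWh fun i => Y i ω) hh
          rw [show W (fun i => Y i ω) - (W (fun i => Y i ω) + (κ * t) • Q) = -((κ * t) • Q) by abel,
            neg_mul, trace_neg, smul_mul_assoc, trace_smul, smul_eq_mul] at this
          simp only
          linarith
      _ ≤ d := by
          refine le_trans (le_of_eq ?_) ih
          refine integral_congr_ae (.of_forall fun ω => ?_)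
          simp only [hW, hc, Finset.card_insert_of_notMem hj]
          congr 2
          push_cast
          rw [add_mul, add_smul, one_mul]
          abel

lemma dotProduct_secondMoment_mulVec (hν : ∀ i j, Integrable (fun y : E d => y i * y j) ν)
    (v : E d) : v.ofLp ⬝ᵥ (secondMoment ν *ᵥ v.ofLp) = ∫ y, inner ℝ v y ^ 2 ∂ν := by
  have : ∀ y : E d, inner ℝ v y ^ 2 = ∑ i, ∑ j, v i * v j * (y i * y j) := fun y => by
    rw [PiLp.inner_apply, sq, Finset.sum_mul_sum]
    refine Finset.sum_congr rfl fun i _ => Finset.sum_congr rfl fun j _ => ?_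
    simp; ring
  simp only [this]
  rw [integral_finsetSum _ fun i _ => integrable_finsetSum _ fun j _ => (hν i j).const_mul _]
  simp only [dotProduct, mulVec, Finset.mul_sum]
  refine Finset.sum_congr rfl fun i _ => ?_
  rw [integral_finsetSum _ fun j _ => (hν i j).const_mul _]
  refine Finset.sum_congr rfl fun j _ => ?_
  rw [integral_const_mul]
  simp only [secondMoment, of_apply]
  ring

/-- Matrix Chernoff bound, in the form of quadratic forms; `t > 0` is the upper tail and `t < 0`
the lower one. -/
lemma measure_sum_sq_gt_le (hd : 1 ≤ d) (hYm : ∀ i, Measurable (Y i))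
    (hYν : ∀ i, μ.map (Y i) = ν) (hνb : ∀ᵐ y ∂ν, ‖y‖ ≤ b) [IsProbabilityMeasure ν]
    (hind : iIndepFun Y μ) (hYb : ∀ i ω, ‖Y i ω‖ ≤ b) {t : ℝ} (ht : |t| * b ^ 2 < 2)
    (s : Finset (Fin n)) {η : ℝ} (hη : 0 < η) :
    μ.real {ω | ¬ ∀ v : E d, t * ∑ i ∈ s, inner ℝ v (Y i ω) ^ 2 ≤
      (s.card : ℝ) * ((1 + t * b ^ 2 / 2) / (1 - t * b ^ 2 / 2) * t) * ∫ y, inner ℝ v y ^ 2 ∂ν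
        + Real.log (d / η) * ‖v‖ ^ 2} ≤ η := by
  have key := integral_trace_exp_sum_le hYm hYν hind hYb ht s
  set κ := (1 + t * b ^ 2 / 2) / (1 - t * b ^ 2 / 2) with hκ
  set Q := secondMoment ν with hQ
  have hQh : Q.IsHermitian := isHermitian_secondMoment ν
  set X : (Fin n → E d) → Matrix (Fin d) (Fin d) ℝ := fun y =>
    ∑ i ∈ s, t • vecMulVec (y i).ofLp (y i).ofLp - ((s.card : ℝ) * (κ * t)) • Q with hX
  have hXc : Continuous X := by
    refine Continuous.sub (continuous_finsetSum _ fun i _ => ?_) continuous_const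
    exact (continuous_vecMulVec_self _).const_smul t
  have hXh : ∀ y, (X y).IsHermitian := fun y => by
    ext a e
    simp [hX, Matrix.sum_apply, vecMulVec_apply, mul_comm, ← hQh.apply a e]
  have hI : Integrable (fun ω => trace (exp (X fun i => Y i ω))) μ :=
    integrable_comp_of_bounded hYm hYb (f := fun y => trace (exp (X y)))
      ((continuous_matrix_exp d).comp hXc).matrix_trace
  have hd0 : (0 : ℝ) < d := by exact_mod_cast hd
  have hpos : ∀ y, 0 ≤ trace (exp (X y)) := fun y => by
    refine Finset.sum_nonneg fun i _ => ?_
    simpa using dotProduct_exp_mulVec_nonneg (hXh y) (Pi.single i 1)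
  -- Markov's inequality at level `d / η`, as the mean of the trace is at most `d`.
  have hmk := mul_meas_ge_le_integral_of_nonneg (μ := μ)
    (.of_forall fun ω => hpos fun i => Y i ω) hI (d / η)
  have hle : μ.real {ω | d / η ≤ trace (exp (X fun i => Y i ω))} ≤ η := by
    have h1 : d / η * μ.real {ω | d / η ≤ trace (exp (X fun i => Y i ω))} ≤ d := hmk.trans key
    rw [div_mul_eq_mul_div, div_le_iff₀ hη] at h1
    exact le_of_mul_le_mul_left h1 hd0
  refine le_trans (measureReal_mono fun ω hω => ?_) hle
  by_contra hcon
  simp only [Set.mem_ofPred_eq, not_le] at hcon hω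
  apply hω
  intro v
  have h1 := dotProduct_mulVec_le_log_mul (hXh fun i => Y i ω) hcon.le v.ofLp
  have hint : ∀ i j, Integrable (fun y : E d => y i * y j) ν := fun i j => by
    refine Integrable.of_bound (C := b * b) (Continuous.aestronglyMeasurable (by fun_prop)) ?_
    filter_upwards [hνb] with y hy
    rw [norm_mul]
    have := fun i => PiLp.norm_apply_le y i
    exact mul_le_mul ((this i).trans hy) ((this j).trans hy) (norm_nonneg _)
      ((norm_nonneg _).trans hy)
  have h2 : v.ofLp ⬝ᵥ (X (fun i => Y i ω) *ᵥ v.ofLp) =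
      t * ∑ i ∈ s, inner ℝ v (Y i ω) ^ 2 - s.card * (κ * t) * ∫ y, inner ℝ v y ^ 2 ∂ν := by
    rw [← dotProduct_secondMoment_mulVec hint]
    simp only [hX, sub_mulVec, sum_mulVec, smul_mulVec, dotProduct_sub, dotProduct_sum,
      dotProduct_smul, smul_eq_mul, Finset.mul_sum]
    congr 1
    refine Finset.sum_congr rfl fun i _ => ?_
    rw [vecMulVec_mulVec]
    have h4 : inner ℝ v (Y i ω) = v.ofLp ⬝ᵥ (Y i ω).ofLp := by
      simp [PiLp.inner_apply, dotProduct, mul_comm]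
    rw [h4, dotProduct_smul, op_smul_eq_smul, smul_eq_mul, dotProduct_comm (Y i ω).ofLp, sq]
  have h3 : v.ofLp ⬝ᵥ v.ofLp = ‖v‖ ^ 2 := by
    rw [EuclideanSpace.real_norm_sq_eq]; simp [dotProduct, sq]
  rw [h2, h3] at h1
  linarith

end Chernoff

end HeavyTail

namespace HeavyTail

/-! ### Uniform distributions on balls -/

section UniformBall

variable {d : ℕ}

/-- The uniform distribution on the closed ball of radius `r` around `v`. -/
def ballUnif (v : E d) (r : ℝ) : Measure (E d) := volume[|Metric.closedBall v r]

lemma volume_closedBall_ne_top (v : E d) (r : ℝ) : volume (Metric.closedBall v r) ≠ ⊤ :=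
  (isCompact_closedBall v r).measure_lt_top.ne

lemma volume_closedBall_ne_zero (v : E d) {r : ℝ} (hr : 0 < r) :
    volume (Metric.closedBall v r) ≠ 0 :=
  (Metric.measure_closedBall_pos volume v hr).ne'

lemma isProbabilityMeasure_ballUnif (v : E d) {r : ℝ} (hr : 0 < r) :
    IsProbabilityMeasure (ballUnif v r) :=
  cond_isProbabilityMeasure_of_finite (volume_closedBall_ne_zero v hr)
    (volume_closedBall_ne_top v r)

lemma ae_ballUnif_mem (v : E d) (r : ℝ) : ∀ᵐ w ∂ballUnif v r, w ∈ Metric.closedBall v r :=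
  ae_cond_mem Metric.isClosed_closedBall.measurableSet

lemma integral_ballUnif (v : E d) (r : ℝ) (f : E d → ℝ) :
    ∫ w, f w ∂ballUnif v r =
      (volume (Metric.closedBall v r)).toReal⁻¹ * ∫ w in Metric.closedBall v r, f w := by
  rw [ballUnif, ProbabilityTheory.cond, integral_smul_measure, ENNReal.toReal_inv, smul_eq_mul]

lemma integrable_ballUnif (v : E d) {r : ℝ} (hr : 0 < r) {f : E d → ℝ} (hf : Continuous f) :
    Integrable f (ballUnif v r) := by
  have := isProbabilityMeasure_ballUnif v hr
  obtain ⟨C, hC⟩ := (isCompact_closedBall v r).exists_bound_of_continuousOn hf.continuousOn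
  refine Integrable.of_bound (C := C) hf.aestronglyMeasurable ?_
  filter_upwards [ae_ballUnif_mem v r] with w hw using hC w hw

lemma integral_ballUnif_add (v : E d) (r : ℝ) (f : E d → ℝ) :
    ∫ w, f w ∂ballUnif v r = ∫ w, f (v + w) ∂ballUnif 0 r := by
  rw [integral_ballUnif, integral_ballUnif]
  have h1 : volume (Metric.closedBall v r) = volume (Metric.closedBall (0 : E d) r) :=
    Measure.addHaar_closedBall_center volume v r
  have h2 := (measurePreserving_add_left (volume : Measure (E d)) v).setIntegral_preimage_emb
    (Homeomorph.addLeft v).measurableEmbedding f (Metric.closedBall v r)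
  rw [preimage_add_closedBall, sub_self] at h2
  rw [h1, ← h2]

lemma integral_ballUnif_isometry (R : E d ≃ₗᵢ[ℝ] E d) (r : ℝ) (f : E d → ℝ) :
    ∫ w, f (R w) ∂ballUnif 0 r = ∫ w, f w ∂ballUnif 0 r := by
  rw [integral_ballUnif, integral_ballUnif]
  have h2 := R.measurePreserving.setIntegral_preimage_emb
    R.toHomeomorph.measurableEmbedding f (Metric.closedBall 0 r)
  rw [LinearIsometryEquiv.preimage_closedBall, map_zero] at h2
  rw [← h2]

/-- The unit ball around `v` lies in the ball of radius `2` around `0`, whose volume is `2^d` times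
larger. This is the change of measure of the PAC-Bayes argument. -/
lemma integral_ballUnif_le_two_pow_mul {v : E d} (hv : ‖v‖ ≤ 1) {f : E d → ℝ} (hf : Continuous f)
    (hf0 : ∀ w, 0 ≤ f w) :
    ∫ w, f w ∂ballUnif v 1 ≤ 2 ^ d * ∫ w, f w ∂ballUnif 0 2 := by
  rw [integral_ballUnif, integral_ballUnif]
  have h1 : volume (Metric.closedBall v 1) = volume (Metric.closedBall (0 : E d) 1) :=
    Measure.addHaar_closedBall_center volume v 1
  have h2 : (volume (Metric.closedBall (0 : E d) 2)).toReal =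
      2 ^ d * (volume (Metric.closedBall (0 : E d) 1)).toReal := by
    have := Measure.addHaar_closedBall_mul volume (0 : E d) (zero_le_two (α := ℝ))
      (zero_le_one (α := ℝ))
    rw [mul_one] at this
    rw [this, ENNReal.toReal_mul, ENNReal.toReal_ofReal (by positivity)]
    simp
  have h3 : 0 < (volume (Metric.closedBall (0 : E d) 1)).toReal :=
    ENNReal.toReal_pos (volume_closedBall_ne_zero _ one_pos) (volume_closedBall_ne_top _ _)
  have h4 : ∫ w in Metric.closedBall v 1, f w ≤ ∫ w in Metric.closedBall 0 2, f w := by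
    refine setIntegral_mono_set (hf.continuousOn.integrableOn_compact (isCompact_closedBall 0 2))
      (.of_forall hf0) (Filter.Eventually.of_forall ?_)
    refine Metric.closedBall_subset_closedBall' ?_
    rw [dist_zero_right]; linarith
  rw [h1, h2, mul_inv, ← mul_assoc, ← mul_assoc, mul_inv_cancel₀ (by positivity), one_mul]
  exact mul_le_mul_of_nonneg_left h4 (inv_nonneg.2 h3.le)

/-- Averaging `⟪·, y⟫²` over a unit ball adds a multiple of `‖y‖²`, the multiple being at
most `1 / d`. -/
lemma exists_integral_ballUnif_inner_sq (hd : 1 ≤ d) :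
    ∃ c : ℝ, 0 ≤ c ∧ c * d ≤ 1 ∧ ∀ v y : E d,
      ∫ w, inner ℝ w y ^ 2 ∂ballUnif v 1 = inner ℝ v y ^ 2 + c * ‖y‖ ^ 2 := by
  have hP := isProbabilityMeasure_ballUnif (0 : E d) one_pos
  set q : E d → ℝ := fun y => ∫ w, inner ℝ w y ^ 2 ∂ballUnif 0 1 with hq
  have hcont : ∀ y : E d, Continuous fun w : E d => inner ℝ w y := fun y => by fun_prop
  have hcont2 : ∀ y : E d, Continuous fun w : E d => inner ℝ w y ^ 2 := fun y => by fun_prop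
  -- Vectors of equal norm are exchanged by a reflection, which preserves the uniform distribution.
  have hrot : ∀ x y : E d, ‖x‖ = ‖y‖ → q x = q y := fun x y hxy => by
    have hR := Submodule.reflection_sub hxy
    set R := Submodule.reflection (ℝ ∙ (x - y))ᗮ
    have := integral_ballUnif_isometry R 1 fun w => inner ℝ w y ^ 2
    rw [hq]; simp only
    rw [← this, ← hR]
    simp only [LinearIsometryEquiv.inner_map_map]
  have hodd : ∀ y : E d, ∫ w, inner ℝ w y ∂ballUnif 0 1 = 0 := fun y => by
    have := integral_ballUnif_isometry (LinearIsometryEquiv.neg ℝ) 1 fun w : E d => inner ℝ w y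
    simp only [LinearIsometryEquiv.coe_neg, inner_neg_left, integral_neg] at this
    linarith
  let e : Fin d → E d := fun i => EuclideanSpace.single i 1
  let i₀ : Fin d := ⟨0, hd⟩
  have he : ∀ i, ‖e i‖ = 1 := fun i => by simp [e]
  refine ⟨q (e i₀), integral_nonneg fun w => sq_nonneg _, ?_, fun v y => ?_⟩
  -- Summing over an orthonormal basis gives the mean of `‖w‖²` on the unit ball, which is at most
  -- `1`.
  · have h1 : q (e i₀) * d = ∑ i, q (e i) := by
      rw [Finset.sum_congr rfl fun i _ => hrot (e i) (e i₀) (by rw [he, he])]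
      simp [mul_comm]
    have h2 : ∑ i, q (e i) = ∫ w : E d, ‖w‖ ^ 2 ∂ballUnif 0 1 := by
      simp only [hq]
      rw [← integral_finsetSum _ fun i _ => integrable_ballUnif 0 one_pos (hcont2 _)]
      refine integral_congr_ae (.of_forall fun w => ?_)
      simp only [e, EuclideanSpace.real_norm_sq_eq]
      refine Finset.sum_congr rfl fun i _ => ?_
      simp [EuclideanSpace.inner_single_right]
    rw [h1, h2]
    have h3 : ∫ w : E d, ‖w‖ ^ 2 ∂ballUnif 0 1 ≤ ∫ _w : E d, (1 : ℝ) ∂ballUnif 0 1 := by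
      refine integral_mono_ae (integrable_ballUnif 0 one_pos (by fun_prop))
        (integrable_const _) ?_
      filter_upwards [ae_ballUnif_mem (0 : E d) 1] with w hw
      rw [mem_closedBall_zero_iff] at hw
      exact pow_le_one₀ (norm_nonneg w) hw
    simpa using h3
  · rw [integral_ballUnif_add]
    have h1 : ∀ w : E d, inner ℝ (v + w) y ^ 2 =
        inner ℝ v y ^ 2 + 2 * inner ℝ v y * inner ℝ w y + inner ℝ w y ^ 2 := fun w => by
      rw [inner_add_left]; ring
    simp only [h1]
    have I1 := integrable_ballUnif (0 : E d) one_pos (hcont y)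
    have I2 := integrable_ballUnif (0 : E d) one_pos (hcont2 y)
    rw [integral_add (f := fun w : E d => inner ℝ v y ^ 2 + 2 * inner ℝ v y * inner ℝ w y) ((integrable_const _).add (I1.const_mul _)) I2,
      integral_add (integrable_const _) (I1.const_mul _), integral_const_mul, hodd]
    have h2 : q y = q (e i₀) * ‖y‖ ^ 2 := by
      rw [← hrot (‖y‖ • e i₀) y (by rw [norm_smul, he]; simp)]
      simp only [hq, inner_smul_right, mul_pow]
      rw [integral_const_mul, mul_comm]
    rw [← h2]
    simp [hq]

end UniformBall

/-! ### PAC-Bayes lower bound for truncated quadratic forms -/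

section PacBayes

variable {n d : ℕ} {Ω : Type*} [MeasurableSpace Ω] {μ : Measure Ω} [IsProbabilityMeasure μ]
  {ν : Measure (E d)} [IsProbabilityMeasure ν] {Y : Fin n → Ω → E d} {b : ℝ}

lemma integrable_of_ae_norm_le (hνb : ∀ᵐ y ∂ν, ‖y‖ ≤ b) {f : E d → ℝ} (hf : Continuous f) :
    Integrable f ν := by
  obtain ⟨C, hC⟩ := (isCompact_closedBall (0 : E d) b).exists_bound_of_continuousOn hf.continuousOn
  refine Integrable.of_bound (C := C) hf.aestronglyMeasurable ?_
  filter_upwards [hνb] with y hy using hC y (by simpa using hy)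

omit [IsProbabilityMeasure ν] in
lemma integrable_prod_ballUnif (hYm : ∀ i, Measurable (Y i)) (hYb : ∀ i ω, ‖Y i ω‖ ≤ b)
    (v : E d) {r : ℝ} (hr : 0 < r) {f : (Fin n → E d) × E d → ℝ} (hf : Continuous f) :
    Integrable (fun p : Ω × E d => f (fun i => Y i p.1, p.2)) (μ.prod (ballUnif v r)) := by
  have := isProbabilityMeasure_ballUnif v hr
  have hK : IsCompact ((Set.univ.pi fun _ : Fin n => Metric.closedBall (0 : E d) b) ×ˢ
      Metric.closedBall v r) :=
    (isCompact_univ_pi fun _ => isCompact_closedBall 0 b).prod (isCompact_closedBall v r)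
  obtain ⟨C, hC⟩ := hK.exists_bound_of_continuousOn hf.continuousOn
  refine Integrable.of_bound (C := C) ?_ ?_
  · exact (hf.measurable.comp ((measurable_pi_lambda _ fun i =>
      (hYm i).comp measurable_fst).prodMk measurable_snd)).aestronglyMeasurable
  · have h1 : ∀ᵐ p ∂μ.prod (ballUnif v r), p.2 ∈ Metric.closedBall v r :=
      (Measure.quasiMeasurePreserving_snd (μ := μ)).ae (ae_ballUnif_mem v r)
    filter_upwards [h1] with p hp
    exact hC (fun i => Y i p.1, p.2) ⟨fun i _ => by simpa using hYb i p.1, hp⟩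

lemma integrable_prod_of_ae_norm_le (hνb : ∀ᵐ y ∂ν, ‖y‖ ≤ b) (v : E d) {r : ℝ} (hr : 0 < r)
    {f : E d × E d → ℝ} (hf : Continuous f) : Integrable f ((ballUnif v r).prod ν) := by
  have := isProbabilityMeasure_ballUnif v hr
  obtain ⟨C, hC⟩ := ((isCompact_closedBall v r).prod
    (isCompact_closedBall (0 : E d) b)).exists_bound_of_continuousOn hf.continuousOn
  refine Integrable.of_bound (C := C) hf.aestronglyMeasurable ?_
  have h1 : ∀ᵐ p ∂(ballUnif v r).prod ν, p.1 ∈ Metric.closedBall v r :=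
    Measure.quasiMeasurePreserving_fst.ae (ae_ballUnif_mem v r)
  have h2 : ∀ᵐ p ∂(ballUnif v r).prod ν, ‖p.2‖ ≤ b :=
    Measure.quasiMeasurePreserving_snd.ae hνb
  filter_upwards [h1, h2] with p hp1 hp2
  exact hC p ⟨hp1, by simpa using hp2⟩

/-- Truncation only matters when `s² > τ`, and then `s² = |s|^k (s²)^(1-k/2) ≤ |s|^k τ^(1-k/2)`. The
loss is thus paid by the `k`-th moment. -/
lemma sub_abs_rpow_mul_le_min {s q k τ : ℝ} (hq : 0 ≤ q) (hk : 2 ≤ k) (hτ : 0 < τ) :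
    s ^ 2 - q - |s| ^ k * τ ^ (1 - k / 2) ≤ min (s ^ 2 - q) τ := by
  have h0 : 0 ≤ |s| ^ k * τ ^ (1 - k / 2) := by positivity
  refine le_min (by linarith) ?_
  rcases le_or_gt (s ^ 2) τ with h | h
  · linarith
  · have hs : 0 < |s| := abs_pos.2 fun h' => by rw [h'] at h; norm_num at h; linarith
    have h1 : (s ^ 2) ^ (1 - k / 2) ≤ τ ^ (1 - k / 2) :=
      Real.rpow_le_rpow_of_nonpos hτ h.le (by linarith)
    have h2 : |s| ^ k * (s ^ 2) ^ (1 - k / 2) = s ^ 2 := by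
      rw [← sq_abs, ← Real.rpow_natCast, ← Real.rpow_mul hs.le, ← Real.rpow_add hs]
      congr 1; push_cast; ring
    have h3 := mul_le_mul_of_nonneg_left h1 (Real.rpow_nonneg hs.le k)
    rw [h2] at h3
    linarith

/-- The smoothed and truncated exponential moment. -/
lemma integral_exp_neg_min_le (hνb : ∀ᵐ y ∂ν, ‖y‖ ≤ b) {k M c l τ : ℝ} (hk : 4 ≤ k)
    (hM : 0 ≤ M) (hc : 0 ≤ c) (hcd : c * d ≤ 1) (hl : 0 < l) (hτ : 0 < τ) (hlτ : l * τ ≤ 1)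
    (hlb : l * (c * b ^ 2) ≤ 1)
    (hmom : ∀ w : E d, ∫ y, |inner ℝ w y| ^ k ∂ν ≤ (M * ‖w‖) ^ k)
    (hmom4 : ∀ w : E d, ∫ y, inner ℝ w y ^ 4 ∂ν ≤ (M * ‖w‖) ^ 4)
    {w : E d} (hw : ‖w‖ ≤ 2) :
    ∫ y, Real.exp (-(l * min (inner ℝ w y ^ 2 - c * ‖y‖ ^ 2) τ)) ∂ν ≤
      Real.exp (-(l * ∫ y, (inner ℝ w y ^ 2 - c * ‖y‖ ^ 2) ∂ν)
        + l * ((2 * M) ^ k * τ ^ (1 - k / 2) + 17 * l * M ^ 4)) := by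
  have hI : ∀ {f : E d → ℝ}, Continuous f → Integrable f ν := integrable_of_ae_norm_le hνb
  have cU : Continuous fun y : E d => inner ℝ w y ^ 2 - c * ‖y‖ ^ 2 := by fun_prop
  have cK : Continuous fun y : E d => |inner ℝ w y| ^ k :=
    Continuous.rpow_const (by fun_prop) fun _ => .inr (by linarith)
  have c4 : Continuous fun y : E d => inner ℝ w y ^ 4 := by fun_prop
  have cN : Continuous fun y : E d => ‖y‖ ^ 4 := by fun_prop
  have hpt : ∀ᵐ y ∂ν, Real.exp (-(l * min (inner ℝ w y ^ 2 - c * ‖y‖ ^ 2) τ)) ≤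
      1 - l * (inner ℝ w y ^ 2 - c * ‖y‖ ^ 2) + l * τ ^ (1 - k / 2) * |inner ℝ w y| ^ k
        + l ^ 2 * (inner ℝ w y ^ 4 + c ^ 2 * ‖y‖ ^ 4) := by
    filter_upwards [hνb] with y hy
    have hq : 0 ≤ c * ‖y‖ ^ 2 := by positivity
    have hqb : l * (c * ‖y‖ ^ 2) ≤ 1 := by
      refine le_trans (mul_le_mul_of_nonneg_left (mul_le_mul_of_nonneg_left ?_ hc) hl.le) hlb
      exact pow_le_pow_left₀ (norm_nonneg y) hy 2
    have hmin := sub_abs_rpow_mul_le_min (s := inner ℝ w y) hq (by linarith : (2 : ℝ) ≤ k) hτ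
    set s : ℝ := inner ℝ w y
    set q := c * ‖y‖ ^ 2 with hqd
    set u := min (s ^ 2 - q) τ with hu
    have hu1 : -q ≤ u := le_min (by nlinarith [sq_nonneg s]) (by linarith)
    have hu2 : u ≤ τ := min_le_right _ _
    have hu3 : u ≤ s ^ 2 - q := min_le_left _ _
    -- The truncation bounds `l u` above by `l τ ≤ 1`, and the smoothing correction bounds it below
    -- by `-l q ≥ -1`; hence `e^x ≤ 1 + x + x²` is available at `x = -l u`.
    have hx : |-(l * u)| ≤ 1 := by
      rw [abs_neg, abs_le]
      constructor <;> nlinarith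
    have hb := (abs_le.1 (Real.abs_exp_sub_one_sub_id_le hx)).2
    have husq : u ^ 2 ≤ s ^ 4 + q ^ 2 := by
      rcases le_or_gt 0 u with h | h
      · nlinarith [sq_nonneg s, sq_nonneg q]
      · nlinarith [sq_nonneg (s ^ 2), sq_nonneg q]
    have e1 : c ^ 2 * ‖y‖ ^ 4 = q ^ 2 := by rw [hqd]; ring
    rw [e1]
    nlinarith [mul_le_mul_of_nonneg_left husq (sq_nonneg l), mul_le_mul_of_nonneg_left hmin hl.le]
  -- Cauchy-Schwarz over coordinates costs `d²`, which `(c d)² ≤ 1` cancels. With `16 M⁴` from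
  -- directions of norm at most `2`, this makes up the constant `17`.
  have hN : c ^ 2 * ∫ y : E d, ‖y‖ ^ 4 ∂ν ≤ M ^ 4 := by
    have h1 : ∀ y : E d, ‖y‖ ^ 4 ≤ d * ∑ i, inner ℝ (EuclideanSpace.single i (1 : ℝ)) y ^ 4 := by
      intro y
      have := sq_sum_le_card_mul_sum_sq (s := Finset.univ) (f := fun i => y i ^ 2)
      rw [← EuclideanSpace.real_norm_sq_eq] at this
      simp only [Finset.card_univ, Fintype.card_fin, ← pow_mul] at this
      simpa [EuclideanSpace.inner_single_left] using this
    have h2 : ∫ y : E d, ‖y‖ ^ 4 ∂ν ≤ d * (d * M ^ 4) := by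
      refine (integral_mono (hI cN) (hI (by fun_prop)) h1).trans ?_
      rw [integral_const_mul]
      refine mul_le_mul_of_nonneg_left ?_ (Nat.cast_nonneg d)
      rw [integral_finsetSum _ fun i _ => hI (by fun_prop)]
      refine (Finset.sum_le_sum fun i _ => hmom4 _).trans ?_
      simp
    have h3 : (c * d) ^ 2 ≤ 1 := pow_le_one₀ (by positivity) hcd
    calc c ^ 2 * ∫ y : E d, ‖y‖ ^ 4 ∂ν ≤ c ^ 2 * (d * (d * M ^ 4)) :=
          mul_le_mul_of_nonneg_left h2 (sq_nonneg c)
      _ = (c * d) ^ 2 * M ^ 4 := by ring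
      _ ≤ 1 * M ^ 4 := mul_le_mul_of_nonneg_right h3 (by positivity)
      _ = M ^ 4 := one_mul _
  have hK : ∫ y, |inner ℝ w y| ^ k ∂ν ≤ (2 * M) ^ k :=
    (hmom w).trans (Real.rpow_le_rpow (by positivity) (by nlinarith) (by linarith))
  have h4 : ∫ y, inner ℝ w y ^ 4 ∂ν ≤ 16 * M ^ 4 :=
    (hmom4 w).trans ((pow_le_pow_left₀ (by positivity)
      (by nlinarith : M * ‖w‖ ≤ 2 * M) 4).trans_eq (by ring))
  refine (integral_mono_ae (hI (by fun_prop)) (hI (by fun_prop)) hpt).trans ?_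
  rw [integral_add (hI (by fun_prop)) (hI (by fun_prop)),
    integral_add (hI (by fun_prop)) (hI (by fun_prop)),
    integral_sub (hI (by fun_prop)) (hI (by fun_prop)),
    integral_const_mul, integral_const_mul, integral_const_mul,
    integral_add (hI c4) (hI (by fun_prop)), integral_const_mul]
  simp only [integral_const, probReal_univ, one_smul]
  refine le_trans ?_ (Real.add_one_le_exp _)
  have hτ' := mul_le_mul_of_nonneg_left hK
    (mul_nonneg hl.le (Real.rpow_nonneg hτ.le (1 - k / 2)))
  nlinarith [mul_le_mul_of_nonneg_left (add_le_add h4 hN) (sq_nonneg l)]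

/-- The centred exponent of the PAC-Bayes argument, for the sample `y` and the direction `w`. -/
def pacExponent (ν : Measure (E d)) (c l τ R : ℝ) (y : Fin n → E d) (w : E d) : ℝ :=
  ∑ i, (-(l * min (inner ℝ w (y i) ^ 2 - c * ‖y i‖ ^ 2) τ)
    + (l * ∫ x, (inner ℝ w x ^ 2 - c * ‖x‖ ^ 2) ∂ν - l * R))

lemma continuous_integral_inner_sq_sub (hνb : ∀ᵐ y ∂ν, ‖y‖ ≤ b) (c : ℝ) :
    Continuous fun w : E d => ∫ x, (inner ℝ w x ^ 2 - c * ‖x‖ ^ 2) ∂ν := by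
  have hI : ∀ {f : E d → ℝ}, Continuous f → Integrable f ν := integrable_of_ae_norm_le hνb
  have : (fun w : E d => ∫ x, (inner ℝ w x ^ 2 - c * ‖x‖ ^ 2) ∂ν) =
      fun w => w.ofLp ⬝ᵥ (Matrix.mulVec (secondMoment ν) w.ofLp) - ∫ y, c * ‖y‖ ^ 2 ∂ν := by
    ext w
    rw [dotProduct_secondMoment_mulVec (fun i j => hI (by fun_prop)), ← integral_sub
      (hI (by fun_prop)) (hI (by fun_prop))]
  rw [this]
  have h : Continuous fun w : E d => w.ofLp := by fun_prop
  exact (h.dotProduct (continuous_const.matrix_mulVec h)).sub continuous_const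

lemma continuous_pacExponent (hνb : ∀ᵐ y ∂ν, ‖y‖ ≤ b) (c l τ R : ℝ) :
    Continuous fun p : (Fin n → E d) × E d => pacExponent ν c l τ R p.1 p.2 := by
  have h1 := (continuous_integral_inner_sq_sub hνb c).comp
    (continuous_snd (X := Fin n → E d) (Y := E d))
  simp only [Function.comp_def] at h1
  unfold pacExponent
  refine continuous_finsetSum _ fun i _ => Continuous.add ?_ ?_
  · fun_prop
  · exact (h1.const_mul l).sub continuous_const

/-- For fixed `w`, independence factors the exponential moment into terms at most `1`. The ball of
radius `2` does not depend on the data, so Fubini preserves this bound after averaging over `w`, and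
Markov's inequality concludes. -/
lemma measure_integral_exp_pacExponent_ge_le (hYm : ∀ i, Measurable (Y i))
    (hYν : ∀ i, μ.map (Y i) = ν) (hνb : ∀ᵐ y ∂ν, ‖y‖ ≤ b)
    (hind : iIndepFun Y μ) (hYb : ∀ i ω, ‖Y i ω‖ ≤ b) {k M c l τ δ : ℝ} (hk : 4 ≤ k)
    (hM : 0 ≤ M) (hc : 0 ≤ c) (hcd : c * d ≤ 1) (hl : 0 < l) (hτ : 0 < τ) (hlτ : l * τ ≤ 1)
    (hlb : l * (c * b ^ 2) ≤ 1) (hδ : 0 < δ)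
    (hmom : ∀ w : E d, ∫ y, |inner ℝ w y| ^ k ∂ν ≤ (M * ‖w‖) ^ k)
    (hmom4 : ∀ w : E d, ∫ y, inner ℝ w y ^ 4 ∂ν ≤ (M * ‖w‖) ^ 4) :
    μ.real {ω | 1 / δ ≤ ∫ w, Real.exp (pacExponent ν c l τ
      ((2 * M) ^ k * τ ^ (1 - k / 2) + 17 * l * M ^ 4) (fun i => Y i ω) w) ∂ballUnif 0 2} ≤ δ := by
  set R := (2 * M) ^ k * τ ^ (1 - k / 2) + 17 * l * M ^ 4 with hR
  have hπ := isProbabilityMeasure_ballUnif (0 : E d) two_pos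
  have hone : ∀ w : E d, ‖w‖ ≤ 2 →
      ∫ ω, Real.exp (pacExponent ν c l τ R (fun i => Y i ω) w) ∂μ ≤ 1 := by
    intro w hw
    set J := ∫ x, (inner ℝ w x ^ 2 - c * ‖x‖ ^ 2) ∂ν with hJ
    set f : E d → ℝ := fun y =>
      Real.exp (-(l * min (inner ℝ w y ^ 2 - c * ‖y‖ ^ 2) τ) + (l * J - l * R)) with hf
    have hfc : Continuous f := by fun_prop
    have h1 : ∀ ω, Real.exp (pacExponent ν c l τ R (fun i => Y i ω) w) = ∏ i, f (Y i ω) :=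
      fun ω => by simp only [pacExponent, hf, hJ, Real.exp_sum]
    simp only [h1]
    rw [hind.integral_fun_prod_comp (f := fun _ => f) (fun i => (hYm i).aemeasurable)
      fun i => hfc.aestronglyMeasurable]
    refine Finset.prod_le_one (fun i _ => integral_nonneg fun ω => (Real.exp_pos _).le)
      fun i _ => ?_
    rw [← integral_map (hYm i).aemeasurable hfc.aestronglyMeasurable, hYν i]
    simp only [hf, Real.exp_add _ (l * J - l * R)]
    rw [integral_mul_const]
    have h2 := integral_exp_neg_min_le hνb hk hM hc hcd hl hτ hlτ hlb hmom hmom4 hw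
    refine (mul_le_mul_of_nonneg_right h2 (Real.exp_pos _).le).trans ?_
    rw [← Real.exp_add]
    refine (Real.exp_le_one_iff).2 (le_of_eq ?_)
    simp only [hJ, hR]
    ring
  have hprod : Integrable
      (fun p : Ω × E d => Real.exp (pacExponent ν c l τ R (fun i => Y i p.1) p.2))
      (μ.prod (ballUnif 0 2)) :=
    integrable_prod_ballUnif hYm hYb 0 two_pos
      (Real.continuous_exp.comp (continuous_pacExponent hνb c l τ R))
  have htot : ∫ ω, ∫ w, Real.exp (pacExponent ν c l τ R (fun i => Y i ω) w) ∂ballUnif 0 2 ∂μ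
      ≤ 1 := by
    rw [integral_integral_swap hprod]
    have h1 : ∫ w, ∫ ω, Real.exp (pacExponent ν c l τ R (fun i => Y i ω) w) ∂μ ∂ballUnif 0 2 ≤
        ∫ _w : E d, (1 : ℝ) ∂ballUnif 0 2 := by
      refine integral_mono_ae hprod.integral_prod_right (integrable_const _) ?_
      filter_upwards [ae_ballUnif_mem (0 : E d) 2] with w hw
      exact hone w (by simpa using hw)
    simpa using h1
  have hmk := mul_meas_ge_le_integral_of_nonneg (μ := μ)
    (f := fun ω => ∫ w, Real.exp (pacExponent ν c l τ R (fun i => Y i ω) w) ∂ballUnif 0 2)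
    (.of_forall fun ω => integral_nonneg fun w => (Real.exp_pos _).le)
    hprod.integral_prod_left (1 / δ)
  have h1 := hmk.trans htot
  rw [div_mul_eq_mul_div, one_mul, div_le_iff₀ hδ] at h1
  linarith

/-- The deterministic half of PAC-Bayes: a single integral over the large ball controls every
direction `v` at once, by passing to the unit ball around `v` and applying Jensen's inequality. -/
lemma le_sum_min_of_integral_exp_lt (hνb : ∀ᵐ y ∂ν, ‖y‖ ≤ b) {c l τ R δ : ℝ}
    (hl : 0 < l) (hδ : 0 < δ)
    (hball : ∀ v y : E d,
      ∫ w, inner ℝ w y ^ 2 ∂ballUnif v 1 = inner ℝ v y ^ 2 + c * ‖y‖ ^ 2)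
    {y : Fin n → E d}
    (hy : ∫ w, Real.exp (pacExponent ν c l τ R y w) ∂ballUnif 0 2 < 1 / δ)
    {v : E d} (hv : ‖v‖ ≤ 1) :
    l * n * (∫ x, inner ℝ v x ^ 2 ∂ν - R) - Real.log (2 ^ d / δ) ≤
      l * ∑ i, min (inner ℝ v (y i) ^ 2) τ := by
  have hρ := isProbabilityMeasure_ballUnif v one_pos
  have hF : Continuous fun w => pacExponent ν c l τ R y w := by
    have h1 : Continuous fun w : E d => (y, w) := by fun_prop
    have h2 := (continuous_pacExponent (n := n) hνb c l τ R).comp h1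
    simpa only [Function.comp_def] using h2
  have hIρ : ∀ {f : E d → ℝ}, Continuous f → Integrable f (ballUnif v 1) :=
    integrable_ballUnif v one_pos
  set K : ℝ := 2 ^ d / δ with hK
  have hKpos : 0 < K := by positivity
  have hexp : ∫ w, Real.exp (pacExponent ν c l τ R y w) ∂ballUnif v 1 ≤ K := by
    refine (integral_ballUnif_le_two_pow_mul hv (Real.continuous_exp.comp hF)
      fun w => (Real.exp_pos _).le).trans ?_
    rw [hK, div_eq_mul_one_div]
    exact mul_le_mul_of_nonneg_left hy.le (by positivity)
  have hjen : ∫ w, pacExponent ν c l τ R y w ∂ballUnif v 1 ≤ Real.log K := by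
    -- Jensen's inequality for the logarithm, through the tangent line of `exp` at `log K`.
    have h1 : ∀ w, pacExponent ν c l τ R y w ≤
        (Real.log K - 1) + Real.exp (pacExponent ν c l τ R y w) * K⁻¹ := fun w => by
      have := Real.add_one_le_exp (pacExponent ν c l τ R y w - Real.log K)
      rw [Real.exp_sub, Real.exp_log hKpos, div_eq_mul_inv] at this
      linarith
    refine (integral_mono (hIρ hF) (hIρ (by fun_prop)) h1).trans ?_
    rw [integral_add (integrable_const _) (hIρ (by fun_prop)), integral_mul_const]
    simp only [integral_const, probReal_univ, one_smul]
    have := mul_le_mul_of_nonneg_right hexp (inv_nonneg.2 hKpos.le)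
    rw [mul_inv_cancel₀ hKpos.ne'] at this
    linarith
  have hJc := continuous_integral_inner_sq_sub hνb c
  have hJavg : ∫ w, ∫ x, (inner ℝ w x ^ 2 - c * ‖x‖ ^ 2) ∂ν ∂ballUnif v 1 =
      ∫ x, inner ℝ v x ^ 2 ∂ν := by
    have hc : Continuous fun p : E d × E d => inner ℝ p.1 p.2 ^ 2 - c * ‖p.2‖ ^ 2 :=
      ((continuous_fst.inner continuous_snd).pow 2).sub
        (continuous_const.mul (continuous_snd.norm.pow 2))
    have hp : Integrable (Function.uncurry fun w x : E d => inner ℝ w x ^ 2 - c * ‖x‖ ^ 2)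
        ((ballUnif v 1).prod ν) := integrable_prod_of_ae_norm_le hνb v one_pos hc
    rw [integral_integral_swap hp]
    refine integral_congr_ae (.of_forall fun x => ?_)
    simp only
    rw [integral_sub (hIρ (by fun_prop)) (integrable_const _), hball]
    simp
  -- By concavity of `min · τ`, averaging goes inside. The term `c ‖x‖²` was subtracted in the
  -- exponent so that the average is exactly `⟪v, x⟫²`.
  have hmin : ∀ x : E d, ∫ w, min (inner ℝ w x ^ 2 - c * ‖x‖ ^ 2) τ ∂ballUnif v 1 ≤
      min (inner ℝ v x ^ 2) τ := fun x => by
    have h0 : Continuous fun w : E d => inner ℝ w x ^ 2 - c * ‖x‖ ^ 2 := by fun_prop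
    refine le_min ?_ ?_
    · refine (integral_mono (hIρ (h0.min continuous_const)) (hIρ h0)
        fun w => min_le_left _ _).trans ?_
      rw [integral_sub (hIρ (by fun_prop)) (integrable_const _), hball]
      simp
    · refine (integral_mono (hIρ (h0.min continuous_const)) (integrable_const τ)
        fun w => min_le_right _ _).trans ?_
      simp
  have hFavg : ∫ w, pacExponent ν c l τ R y w ∂ballUnif v 1 =
      ∑ i, (-(l * ∫ w, min (inner ℝ w (y i) ^ 2 - c * ‖y i‖ ^ 2) τ ∂ballUnif v 1)
        + (l * ∫ x, inner ℝ v x ^ 2 ∂ν - l * R)) := by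
    have hA : ∀ i, Integrable
        (fun w => -(l * min (inner ℝ w (y i) ^ 2 - c * ‖y i‖ ^ 2) τ)) (ballUnif v 1) :=
      fun i => hIρ (by fun_prop)
    have hB : Integrable
        (fun w => l * ∫ x, (inner ℝ w x ^ 2 - c * ‖x‖ ^ 2) ∂ν) (ballUnif v 1) :=
      hIρ (hJc.const_mul l)
    have hB' : Integrable
        (fun w => l * ∫ x, (inner ℝ w x ^ 2 - c * ‖x‖ ^ 2) ∂ν - l * R) (ballUnif v 1) :=
      hB.sub (integrable_const _)
    have hAB : ∀ i, Integrable (fun w => -(l * min (inner ℝ w (y i) ^ 2 - c * ‖y i‖ ^ 2) τ)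
        + (l * ∫ x, (inner ℝ w x ^ 2 - c * ‖x‖ ^ 2) ∂ν - l * R)) (ballUnif v 1) :=
      fun i => (hA i).add hB'
    unfold pacExponent
    rw [integral_finsetSum _ fun i _ => hAB i]
    refine Finset.sum_congr rfl fun i _ => ?_
    rw [integral_add (hA i) hB', integral_neg, integral_const_mul,
      integral_sub hB (integrable_const _), integral_const_mul, hJavg]
    simp
  rw [hFavg, Finset.sum_add_distrib, Finset.sum_neg_distrib, ← Finset.mul_sum] at hjen
  simp only [Finset.sum_const, Finset.card_univ, Fintype.card_fin, nsmul_eq_mul] at hjen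
  have hs := mul_le_mul_of_nonneg_left
    (Finset.sum_le_sum fun i (_ : i ∈ Finset.univ) => hmin (y i)) hl.le
  linarith

/-- A uniform lower bound for truncated quadratic forms, from the PAC-Bayes argument with uniform
distributions on balls. -/
lemma measure_sum_min_lt_le (hd : 1 ≤ d) (hYm : ∀ i, Measurable (Y i))
    (hYν : ∀ i, μ.map (Y i) = ν) (hνb : ∀ᵐ y ∂ν, ‖y‖ ≤ b)
    (hind : iIndepFun Y μ) (hYb : ∀ i ω, ‖Y i ω‖ ≤ b) {k M l τ δ : ℝ} (hk : 4 ≤ k)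
    (hM : 0 ≤ M) (hl : 0 < l) (hτ : 0 < τ) (hlτ : l * τ ≤ 1) (hlb : l * b ^ 2 ≤ d) (hδ : 0 < δ)
    (hmom : ∀ w : E d, ∫ y, |inner ℝ w y| ^ k ∂ν ≤ (M * ‖w‖) ^ k)
    (hmom4 : ∀ w : E d, ∫ y, inner ℝ w y ^ 4 ∂ν ≤ (M * ‖w‖) ^ 4) :
    μ.real {ω | ¬ ∀ v : E d, ‖v‖ ≤ 1 →
      l * n * (∫ y, inner ℝ v y ^ 2 ∂ν - ((2 * M) ^ k * τ ^ (1 - k / 2) + 17 * l * M ^ 4))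
        - Real.log (2 ^ d / δ) ≤ l * ∑ i, min (inner ℝ v (Y i ω) ^ 2) τ} ≤ δ := by
  obtain ⟨c, hc, hcd, hball⟩ := exists_integral_ballUnif_inner_sq hd
  have hlb' : l * (c * b ^ 2) ≤ 1 := by
    calc l * (c * b ^ 2) = c * (l * b ^ 2) := by ring
      _ ≤ c * d := mul_le_mul_of_nonneg_left hlb hc
      _ ≤ 1 := hcd
  refine le_trans (measureReal_mono fun ω hω => ?_) (measure_integral_exp_pacExponent_ge_le
    hYm hYν hνb hind hYb hk hM hc hcd hl hτ hlτ hlb' hδ hmom hmom4)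
  by_contra hcon
  exact hω fun v hv => le_sum_min_of_integral_exp_lt hνb hl hδ hball (not_le.1 hcon) hv

end PacBayes

end HeavyTail

namespace HeavyTail

/-! ### Truncation identity, choice of level, and numerical constants -/

section Combine

variable {n d : ℕ}

lemma card_half₁ (n : ℕ) : (half₁ n).card = n / 2 := by
  rw [half₁, Fin.card_filter_val_lt]
  exact min_eq_right (Nat.div_le_self n 2)

lemma card_half₂ (n : ℕ) : (half₂ n).card = n - n / 2 := by
  rw [half₂, Finset.card_compl, card_half₁, Fintype.card_fin]

/-- The excess `x - min x τ` is nonnegative, so its sum over `T` is at most its sum over all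
indices; the truncated part on `T` is at most `|T| τ`. -/
lemma sum_add_sum_min_le {ι : Type*} [Fintype ι] {x : ι → ℝ} {τ : ℝ} (T : Finset ι) :
    ∑ i ∈ T, x i + ∑ i, min (x i) τ ≤ ∑ i, x i + T.card * τ := by
  have h1 : ∑ i ∈ T, (x i - min (x i) τ) ≤ ∑ i, (x i - min (x i) τ) :=
    Finset.sum_le_univ_sum_of_nonneg fun i => sub_nonneg.2 (min_le_left _ _)
  have h2 : ∑ i ∈ T, min (x i) τ ≤ T.card * τ := by
    refine (Finset.sum_le_sum fun i _ => min_le_right (x i) τ).trans_eq ?_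
    simp
  rw [Finset.sum_sub_distrib, Finset.sum_sub_distrib] at h1
  linarith

/-- At this level `τ` the truncation bias `(2M)^k τ^(1-k/2)` equals `x τ`, computed in
`mul_truncation`: the two errors are balanced. -/
lemma rpow_mul_truncation_rpow {M x k : ℝ} (hM : 0 < M) (hx : 0 < x) (hk : 0 < k) :
    (2 * M) ^ k * (4 * M ^ 2 * x ^ (-(2 / k))) ^ (1 - k / 2) = 4 * M ^ 2 * x ^ (1 - 2 / k) := by
  have h1 : (4 * M ^ 2 : ℝ) = (2 * M) ^ (2 : ℝ) := by
    rw [show (2 : ℝ) = ((2 : ℕ) : ℝ) by norm_num, Real.rpow_natCast]; push_cast; ring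
  have h2 : (0 : ℝ) < 2 * M := by positivity
  rw [h1, Real.mul_rpow (x := (2 * M) ^ (2 : ℝ)) (by positivity) (by positivity), ← Real.rpow_mul h2.le,
    ← Real.rpow_mul hx.le, ← mul_assoc, ← Real.rpow_add h2]
  congr 2
  · ring
  · field_simp; ring

lemma mul_truncation {M x k : ℝ} (hx : 0 < x) :
    x * (4 * M ^ 2 * x ^ (-(2 / k))) = 4 * M ^ 2 * x ^ (1 - 2 / k) := by
  rw [sub_eq_add_neg, Real.rpow_add hx, Real.rpow_one]; ring

/-- From `δ < 1/4`, `log(1/δ) ≥ 2 log 2 > 1`, so the constants `log 2` and `1` are absorbed into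
`log(d/δ)`. -/
lemma log_two_mul_div_le {δ : ℝ} (hd : 1 ≤ d) (hδ : 0 < δ) (hδ' : δ < 1 / 4) :
    2 ≤ Real.log (2 * d / δ) ∧ Real.log (2 * d / δ) ≤ 3 / 2 * Real.log (d / δ) ∧
      (d + Real.log (1 / δ)) / d ≤ 2 * Real.log (d / δ) ∧ 0 < Real.log (1 / δ) := by
  have hd0 : (1 : ℝ) ≤ d := by exact_mod_cast hd
  have hl2 := Real.log_two_gt_d9
  have h4 : Real.log 4 = 2 * Real.log 2 := by
    rw [show (4 : ℝ) = 2 ^ 2 by norm_num, Real.log_pow]; norm_num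
  have hinv : 4 < 1 / δ := by rw [lt_div_iff₀ hδ]; linarith
  have h1 : Real.log 4 ≤ Real.log (1 / δ) := Real.log_le_log (by norm_num) hinv.le
  have h2 : Real.log (1 / δ) ≤ Real.log (d / δ) :=
    Real.log_le_log (by positivity) (div_le_div_of_nonneg_right hd0 hδ.le)
  have h3 : Real.log (2 * d / δ) = Real.log 2 + Real.log (d / δ) := by
    rw [mul_div_assoc, Real.log_mul (by norm_num) (by positivity)]
  refine ⟨by linarith, by linarith, ?_, by linarith⟩
  rw [add_div, div_self (by positivity)]
  have h5 : Real.log (1 / δ) / d ≤ Real.log (1 / δ) :=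
    div_le_self (by linarith) hd0
  linarith

/-- Rounding changes `n / 2` by at most `1/2`, which is at most `0.005 n` once `n ≥ 100`. -/
lemma half_card_bounds {n : ℕ} (hn : 100 ≤ n) {H : Finset (Fin n)}
    (hH : H = half₁ n ∨ H = half₂ n) :
    0.495 * (n : ℝ) ≤ H.card ∧ (H.card : ℝ) ≤ 0.505 * n := by
  have h1 : 1000 * H.card ≤ 505 * n ∧ 495 * n ≤ 1000 * H.card := by
    rcases hH with rfl | rfl
    · rw [card_half₁]; omega
    · rw [card_half₂]; omega
  obtain ⟨h2, h3⟩ := h1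
  have h2' : (1000 : ℝ) * H.card ≤ 505 * n := by exact_mod_cast h2
  have h3' : (495 : ℝ) * n ≤ 1000 * H.card := by exact_mod_cast h3
  constructor <;> linarith

/-- Meant for `t = e / b²` and `e² = b² L / N`: then `t b² = e`, and the logarithmic term divided by
`t` is `N e`. -/
lemma chernoff_upper_le {N c e q L t S : ℝ} (hc : 0 ≤ c) (hq : 0 ≤ q)
    (he : 0 ≤ e) (he1 : e ≤ 1) (ht : 0 < t) (hL : L = t * (N * e))
    (h : t * S ≤ c * ((1 + e / 2) / (1 - e / 2) * t) * q + L) :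
    S ≤ c * (1 + 2 * e) * q + N * e := by
  have hκ : (1 + e / 2) / (1 - e / 2) ≤ 1 + 2 * e := by
    rw [div_le_iff₀ (by linarith)]; nlinarith
  have h1 : t * S ≤ t * (c * ((1 + e / 2) / (1 - e / 2)) * q + N * e) := by
    rw [hL] at h; linarith
  have h2 := le_of_mul_le_mul_left h1 ht
  have h3 := mul_le_mul_of_nonneg_left hκ (mul_nonneg hc hq)
  linarith

lemma chernoff_lower_le {N c e q L t S : ℝ} (hc : 0 ≤ c) (hq : 0 ≤ q)
    (he : 0 ≤ e) (ht : 0 < t) (hL : L = t * (N * e))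
    (h : -t * S ≤ c * ((1 + -e / 2) / (1 - -e / 2) * -t) * q + L) :
    c * (1 - e) * q - N * e ≤ S := by
  have hκ : 1 - e ≤ (1 + -e / 2) / (1 - -e / 2) := by
    rw [le_div_iff₀ (by linarith)]; nlinarith
  have h1 : t * (c * ((1 + -e / 2) / (1 - -e / 2)) * q - N * e) ≤ t * S := by
    rw [hL] at h; linarith
  have h2 := le_of_mul_le_mul_left h1 ht
  have h3 := mul_le_mul_of_nonneg_left hκ (mul_nonneg hc hq)
  linarith

/-- The claim is `S₁ ≤ 3 S₂`. The tolerances leave ample room: `S₁ ≤ 0.631 N q` and `S₂ ≥ 0.395 N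
q`. -/
lemma half_le_three_quarters {N c₁ c₂ e q S₁ S₂ : ℝ} (hN : 0 ≤ N) (he : 0 ≤ e)
    (he1 : e ≤ 1 / 20) (hq : 2 / 3 ≤ q) (hc₁ : c₁ ≤ 0.505 * N)
    (hc₂ : 0.495 * N ≤ c₂) (h₁ : S₁ ≤ c₁ * (1 + 2 * e) * q + N * e)
    (h₂ : c₂ * (1 - e) * q - N * e ≤ S₂) : S₁ ≤ 3 / 4 * (S₁ + S₂) := by
  have a1 : c₁ * (1 + 2 * e) * q ≤ 0.505 * N * 1.1 * q := by
    refine mul_le_mul_of_nonneg_right ?_ (by linarith)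
    exact mul_le_mul hc₁ (by linarith) (by linarith) (by positivity)
  have a2 : 0.495 * N * 0.95 * q ≤ c₂ * (1 - e) * q := by
    refine mul_le_mul_of_nonneg_right ?_ (by linarith)
    exact mul_le_mul hc₂ (by linarith) (by norm_num) (by nlinarith)
  have a3 : N * e ≤ 0.075 * (N * q) := by nlinarith
  have a4 : 0 ≤ N * q := by nlinarith
  nlinarith

lemma quarter_le_half {N c e q S : ℝ} (hN : 0 ≤ N) (he1 : e ≤ 1 / 20) (hq : 2 / 3 ≤ q)
    (hc : 0.495 * N ≤ c) (h : c * (1 - e) * q - N * e ≤ S) : N / 4 ≤ S := by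
  have a2 : 0.495 * N * 0.95 * (2 / 3) ≤ c * (1 - e) * q := by
    refine mul_le_mul (mul_le_mul hc (by linarith) (by norm_num) (by nlinarith)) hq (by norm_num)
      (mul_nonneg (by nlinarith) (by linarith))
  nlinarith

end Combine

end HeavyTail

namespace HeavyTail

/-! ### Resilience of the whitened sample -/

section Core

variable {n d : ℕ}

set_option maxHeartbeats 1000000 in
/-- The deterministic part of the resilience bound, for one unit direction with projections `x`
of the sample. -/
lemma sum_subset_le_rate_mul {k M b δ q S : ℝ} {m : ℕ} {x : Fin n → ℝ} {T : Finset (Fin n)}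
    (hd : 1 ≤ d) (hk : 4 ≤ k) (hM : 0 < M) (hb : 0 < b) (hδ : 0 < δ) (hδ' : δ < 1 / 4)
    (hn : 400 * (b ^ 2 * Real.log (2 * d / δ)) ≤ n) (hT : T.card ≤ m)
    (hq1 : q ≤ 1) {e l τ : ℝ}
    (hed : e = √(b ^ 2 * Real.log (2 * d / δ) / n))
    (hτd : τ = 4 * M ^ 2 * (max (m : ℝ) (d + Real.log (1 / δ)) / n) ^ (-(2 / k)))
    (hld : l = min (1 / τ) (min (√((d + Real.log (1 / δ)) / n) / M ^ 2) (d / b ^ 2)))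
    (hup : ∑ i, x i ≤ n * (1 + 2 * e) * q + 2 * (n * e))
    (hlow : l * n * (q - ((2 * M) ^ k * τ ^ (1 - k / 2) + 17 * l * M ^ 4))
        - Real.log (2 ^ d / δ) ≤ l * ∑ i, min (x i) τ)
    (hS : n / 4 ≤ S) :
    ∑ i ∈ T, x i ≤ 100 * rate d n m k M b δ * S := by
  obtain ⟨hL2, hL3, hD0d, hlogδ⟩ := log_two_mul_div_le hd hδ hδ'
  set L := Real.log (2 * d / δ)
  set L' := Real.log (d / δ)
  set D₀ := d + Real.log (1 / δ) with hD₀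
  set D := max (m : ℝ) D₀ with hD
  have hd1 : (1 : ℝ) ≤ d := by exact_mod_cast hd
  have hn0 : (0 : ℝ) < n := by
    have : 0 < b ^ 2 * L := by positivity
    linarith
  have hD₀0 : 0 < D₀ := by linarith
  have hDD₀ : D₀ ≤ D := le_max_right _ _
  have hDm : (m : ℝ) ≤ D := le_max_left _ _
  have hx0 : 0 < D / n := by positivity
  have hτ0 : 0 < τ := by rw [hτd]; positivity
  have hw0 : 0 < √(D₀ / n) := Real.sqrt_pos.2 (by positivity)
  have hl0 : 0 < l := by
    rw [hld]; exact lt_min (by positivity) (lt_min (by positivity) (by positivity))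
  set A := √(b ^ 2 * L' / n) with hA
  set B := M ^ 2 * √(D₀ / n) with hB
  set G := M ^ 2 * (D / n) ^ (1 - 2 / k) with hG
  have hA0 : 0 ≤ A := Real.sqrt_nonneg _
  have hB0 : 0 ≤ B := by positivity
  have hG0 : 0 ≤ G := by positivity
  have hrate : rate d n m k M b δ = A + B + G := rfl
  have hA2 : A ^ 2 = b ^ 2 * L' / n := Real.sq_sqrt (by
    have : 0 ≤ L' := by linarith
    positivity)
  have he2 : e ^ 2 = b ^ 2 * L / n := by rw [hed]; exact Real.sq_sqrt (by positivity)
  have he0 : 0 ≤ e := by rw [hed]; exact Real.sqrt_nonneg _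
  have heA : e ≤ 1.3 * A := by
    refine abs_le_of_sq_le_sq' ?_ (by positivity) |>.2
    rw [mul_pow, he2, hA2]
    have : b ^ 2 * L / n ≤ b ^ 2 * (3 / 2 * L') / n := by gcongr
    have h0 : 0 ≤ b ^ 2 * L' / n := hA2 ▸ sq_nonneg A
    calc b ^ 2 * L / n ≤ b ^ 2 * (3 / 2 * L') / n := this
      _ = 3 / 2 * (b ^ 2 * L' / n) := by ring
      _ ≤ _ := by linarith
  have hA1 : A ≤ 1 := by
    refine abs_le_of_sq_le_sq' ?_ zero_le_one |>.2
    rw [hA2, one_pow, div_le_one hn0]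
    have hLL : L' ≤ L := Real.log_le_log (by positivity) (by gcongr; linarith)
    have i1 := mul_le_mul_of_nonneg_left hLL (sq_nonneg b)
    have i2 := mul_nonneg (sq_nonneg b) (by linarith : 0 ≤ L)
    linarith
  have h1 : (2 * M) ^ k * τ ^ (1 - k / 2) = 4 * G := by
    rw [hτd, rpow_mul_truncation_rpow hM hx0 (by linarith), hG]; ring
  have h2 : D * τ = n * (4 * G) := by
    have := mul_truncation (M := M) (k := k) hx0
    rw [← hτd] at this
    have h : D * τ = n * (D / n * τ) := by field_simp
    rw [h, this, hG]; ring
  have h3 : l * M ^ 4 ≤ B := by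
    have : l ≤ √(D₀ / n) / M ^ 2 := hld ▸ (min_le_right _ _).trans (min_le_left _ _)
    calc l * M ^ 4 ≤ √(D₀ / n) / M ^ 2 * M ^ 4 := by gcongr
      _ = B := by rw [hB]; field_simp
  -- `1 / l` is the largest of three reciprocals. Multiplied by `D₀`, they produce the terms `G`,
  -- `B` and `A` of the rate, respectively.
  have h4 : 1 / l ≤ τ + M ^ 2 / √(D₀ / n) + b ^ 2 / d := by
    have p1 : 0 ≤ M ^ 2 / √(D₀ / n) := by positivity
    have p2 : 0 ≤ b ^ 2 / (d : ℝ) := by positivity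
    rcases min_choice (1 / τ) (min (√(D₀ / n) / M ^ 2) (d / b ^ 2)) with h | h
    · rw [hld, h, one_div_one_div]; linarith
    · rcases min_choice (√(D₀ / n) / M ^ 2) (d / b ^ 2) with h' | h'
      · rw [hld, h, h', one_div_div]; linarith
      · rw [hld, h, h', one_div_div]; linarith
  have h5 : D₀ * (1 / l) ≤ n * (4 * G + B + 2 * A) := by
    have q1 : D₀ * τ ≤ n * (4 * G) := h2 ▸ mul_le_mul_of_nonneg_right hDD₀ hτ0.le
    have q2 : D₀ * (M ^ 2 / √(D₀ / n)) = n * B := by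
      have hs : √(D₀ / n) * √(D₀ / n) = D₀ / n := Real.mul_self_sqrt (by positivity)
      rw [hB, ← mul_div_assoc, div_eq_iff hw0.ne']
      calc D₀ * M ^ 2 = n * M ^ 2 * (D₀ / n) := by field_simp
        _ = n * M ^ 2 * (√(D₀ / n) * √(D₀ / n)) := by rw [hs]
        _ = n * (M ^ 2 * √(D₀ / n)) * √(D₀ / n) := by ring
    have q3 : D₀ * (b ^ 2 / d) ≤ n * (2 * A) := by
      calc D₀ * (b ^ 2 / d) = b ^ 2 * (D₀ / d) := by ring
        _ ≤ b ^ 2 * (2 * L') := by gcongr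
        _ = n * (2 * A ^ 2) := by rw [hA2]; field_simp
        -- The constraint `l b² ≤ d` costs only order `A²`, and `A ≤ 1`.
        _ ≤ n * (2 * A) := by
          refine mul_le_mul_of_nonneg_left ?_ hn0.le
          have := mul_le_mul_of_nonneg_left hA1 hA0
          linarith
    calc D₀ * (1 / l) ≤ D₀ * (τ + M ^ 2 / √(D₀ / n) + b ^ 2 / d) := by gcongr
      _ = D₀ * τ + D₀ * (M ^ 2 / √(D₀ / n)) + D₀ * (b ^ 2 / d) := by ring
      _ ≤ n * (4 * G + B + 2 * A) := by rw [q2]; linarith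
  have h6 : Real.log (2 ^ d / δ) ≤ D₀ := by
    rw [div_eq_mul_one_div, Real.log_mul (by positivity) (by positivity), Real.log_pow, hD₀]
    have hlog : Real.log 2 ≤ 1 := by have := Real.log_two_lt_d9; linarith
    have := mul_le_mul_of_nonneg_left hlog (by linarith : (0 : ℝ) ≤ d)
    linarith
  have hmin : n * (q - (4 * G + 17 * B)) - n * (4 * G + B + 2 * A) ≤ ∑ i, min (x i) τ := by
    rw [h1] at hlow
    have r1 : n * (q - (4 * G + 17 * l * M ^ 4)) - Real.log (2 ^ d / δ) * (1 / l) ≤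
        ∑ i, min (x i) τ := by
      refine le_of_mul_le_mul_left (le_trans (le_of_eq ?_) hlow) hl0
      field_simp
    have r2 : Real.log (2 ^ d / δ) * (1 / l) ≤ D₀ * (1 / l) := by gcongr
    have r3 := mul_le_mul_of_nonneg_left h3 hn0.le
    linarith
  have hTτ : (T.card : ℝ) * τ ≤ n * (4 * G) := by
    rw [← h2]
    have : (T.card : ℝ) ≤ m := by exact_mod_cast hT
    exact mul_le_mul_of_nonneg_right (this.trans hDm) hτ0.le
  have hall : ∑ i, x i ≤ n * (q + 4 * e) := by
    have : n * e * q ≤ n * e * 1 := mul_le_mul_of_nonneg_left hq1 (by positivity)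
    linarith
  have hsplit := sum_add_sum_min_le (x := x) (τ := τ) T
  have hneA : n * e ≤ n * (1.3 * A) := mul_le_mul_of_nonneg_left heA hn0.le
  have p1 := mul_nonneg hn0.le hA0
  have p2 := mul_nonneg hn0.le hB0
  have p3 := mul_nonneg hn0.le hG0
  -- The main term `n q` cancels between `hall` and `hmin`; what remains is at most `n (7.2 A + 18 B
  -- + 12 G)`. The bound `n ≤ 4 S` then turns `25` into `100`.
  have hfin : ∑ i ∈ T, x i ≤ 25 * (A + B + G) * n := by linarith
  rw [hrate]
  have := mul_le_mul_of_nonneg_left hS (by positivity : 0 ≤ 100 * (A + B + G))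
  linarith

variable {Ω : Type*} [MeasurableSpace Ω] {μ : Measure Ω} [IsProbabilityMeasure μ]
  {ν : Measure (E d)} [IsProbabilityMeasure ν] {Y : Fin n → Ω → E d} {b : ℝ}

/-- The resilience inequalities in the direction `v`. -/
def ResilientAt (y : Fin n → E d) (m : ℕ) (α : ℝ) (v : E d) : Prop :=
  ∀ H : Finset (Fin n), H = half₁ n ∨ H = half₂ n →
    ∑ i ∈ H, inner ℝ v (y i) ^ 2 ≤ 3 / 4 * ∑ i, inner ℝ v (y i) ^ 2 ∧
    ∀ T : Finset (Fin n), T ⊆ H → T.card ≤ m →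
      ∑ i ∈ T, inner ℝ v (y i) ^ 2 ≤ α * ∑ i ∈ H, inner ℝ v (y i) ^ 2

lemma ResilientAt.smul {y : Fin n → E d} {m : ℕ} {α : ℝ} {v : E d}
    (h : ResilientAt y m α v) (c : ℝ) : ResilientAt y m α (c • v) := by
  intro H hH
  obtain ⟨h1, h2⟩ := h H hH
  simp only [real_inner_smul_left, mul_pow, ← Finset.mul_sum]
  refine ⟨?_, fun T hTH hT => ?_⟩
  · nlinarith [mul_le_mul_of_nonneg_left h1 (sq_nonneg c)]
  · nlinarith [mul_le_mul_of_nonneg_left (h2 T hTH hT) (sq_nonneg c)]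

lemma sum_half₁_add_sum_half₂ (f : Fin n → ℝ) :
    ∑ i ∈ half₁ n, f i + ∑ i ∈ half₂ n, f i = ∑ i, f i :=
  Finset.sum_add_sum_compl _ _

/-- Four Chernoff events (two halves, two tails) of probability `δ/2` each and one PAC-Bayes event
of probability `δ` add up to `3δ`. Only directions with second moment comparable to `‖v‖²` are
claimed, since a singular `Σ` gives no lower bound on its kernel. -/
lemma measure_not_resilientAt_le (hd : 1 ≤ d) {k M δ : ℝ} {m : ℕ} (hk : 4 ≤ k) (hM : 0 ≤ M)
    (hb : 0 < b) (hδ : 0 < δ) (hδ' : δ < 1 / 4)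
    (hn : 400 * (b ^ 2 * Real.log (2 * d / δ)) ≤ n)
    (hYm : ∀ i, Measurable (Y i)) (hYν : ∀ i, μ.map (Y i) = ν) (hνb : ∀ᵐ y ∂ν, ‖y‖ ≤ b)
    (hind : iIndepFun Y μ) (hYb : ∀ i ω, ‖Y i ω‖ ≤ b)
    (hmom : ∀ w : E d, ∫ y, |inner ℝ w y| ^ k ∂ν ≤ (M * ‖w‖) ^ k)
    (hmom4 : ∀ w : E d, ∫ y, inner ℝ w y ^ 4 ∂ν ≤ (M * ‖w‖) ^ 4) :
    μ.real {ω | ¬ ∀ v : E d, 2 / 3 * ‖v‖ ^ 2 ≤ ∫ y, inner ℝ v y ^ 2 ∂ν →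
      ∫ y, inner ℝ v y ^ 2 ∂ν ≤ ‖v‖ ^ 2 →
      ResilientAt (fun i => Y i ω) m (100 * rate d n m k M b δ) v} ≤ 3 * δ := by
  have hzero : ∀ ω, ResilientAt (fun i => Y i ω) m (100 * rate d n m k M b δ) (0 : E d) := by
    intro ω H hH
    simp
  have hI : ∀ {f : E d → ℝ}, Continuous f → Integrable f ν := integrable_of_ae_norm_le hνb
  -- Without such a unit vector only `v = 0` has to be checked. With one, `b² ≥ 2/3` (whence `n ≥
  -- 100`) and `M > 0` follow.
  by_cases hex : ∃ v : E d, ‖v‖ = 1 ∧ 2 / 3 ≤ ∫ y, inner ℝ v y ^ 2 ∂ν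
  swap
  · have hempty : {ω | ¬ ∀ v : E d, 2 / 3 * ‖v‖ ^ 2 ≤ ∫ y, inner ℝ v y ^ 2 ∂ν →
        ∫ y, inner ℝ v y ^ 2 ∂ν ≤ ‖v‖ ^ 2 →
        ResilientAt (fun i => Y i ω) m (100 * rate d n m k M b δ) v} = ∅ := by
      refine Set.eq_empty_iff_forall_notMem.2 fun ω hω => hω fun v hv1 hv2 => ?_
      rcases eq_or_ne v 0 with rfl | hv
      · exact hzero ω
      · exfalso
        have hv0 : 0 < ‖v‖ := norm_pos_iff.2 hv
        refine hex ⟨‖v‖⁻¹ • v, by rw [norm_smul, norm_inv, norm_norm, inv_mul_cancel₀ hv0.ne'], ?_⟩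
        simp only [real_inner_smul_left, mul_pow]
        rw [integral_const_mul, inv_pow, inv_mul_eq_div, le_div_iff₀ (by positivity)]
        exact hv1
    rw [hempty]
    simp; positivity
  obtain ⟨v₀, hv₀, hQ₀⟩ := hex
  have hb23 : 2 / 3 ≤ b ^ 2 := by
    refine hQ₀.trans ?_
    have : ∫ y, inner ℝ v₀ y ^ 2 ∂ν ≤ ∫ _y, b ^ 2 ∂ν := by
      refine integral_mono_ae (hI (by fun_prop)) (integrable_const _) ?_
      filter_upwards [hνb] with y hy
      have h1 := abs_real_inner_le_norm v₀ y
      rw [hv₀, one_mul] at h1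
      rw [← sq_abs]
      exact pow_le_pow_left₀ (abs_nonneg _) (h1.trans hy) 2
    simpa using this
  have hM0 : 0 < M := by
    rcases hM.lt_or_eq with h | h
    · exact h
    · exfalso
      have h4 := hmom4 v₀
      rw [← h] at h4
      -- Since `s⁴ ≥ 2 s² - 1`, the fourth moment is at least `2 · (2/3) - 1 = 1/3`, which excludes
      -- `M = 0`.
      have h5 : ∫ y, (2 * inner ℝ v₀ y ^ 2 - 1) ∂ν ≤ ∫ y, inner ℝ v₀ y ^ 4 ∂ν :=
        integral_mono (hI (by fun_prop)) (hI (by fun_prop)) fun y => by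
          nlinarith [sq_nonneg ((inner ℝ v₀ y : ℝ) ^ 2 - 1)]
      rw [integral_sub (hI (by fun_prop)) (integrable_const _), integral_const_mul] at h5
      simp at h5 h4
      linarith
  obtain ⟨hL2, hL3, hD0d, hlogδ⟩ := log_two_mul_div_le hd hδ hδ'
  set L := Real.log (2 * d / δ) with hL
  have hn0 : (0 : ℝ) < n := by
    have : 0 < b ^ 2 * L := by positivity
    linarith
  have hn100 : 100 ≤ n := by
    have : (100 : ℝ) ≤ n := by nlinarith
    exact_mod_cast this
  have hd1 : (1 : ℝ) ≤ d := by exact_mod_cast hd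
  -- The constant `400` in the sample size is what gives `e ≤ 1/20`.
  set e := √(b ^ 2 * L / n) with he
  have he2 : e ^ 2 = b ^ 2 * L / n := Real.sq_sqrt (by positivity)
  have he0 : 0 < e := Real.sqrt_pos.2 (by positivity)
  have he20 : e ≤ 1 / 20 := by
    refine abs_le_of_sq_le_sq' ?_ (by norm_num) |>.2
    rw [he2, div_le_iff₀ hn0]
    linarith
  set t := e / b ^ 2 with ht
  have ht0 : 0 < t := by positivity
  have htb : t * b ^ 2 = e := div_mul_cancel₀ _ (by positivity)
  have hLt : L = t * (n * e) := by
    have : L = e ^ 2 * n / b ^ 2 := by rw [he2]; field_simp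
    rw [this, ht]; ring
  have hlogη : Real.log (d / (δ / 2)) = L := by
    rw [hL]; congr 1; field_simp
  have hchU := fun s => measure_sum_sq_gt_le hd hYm hYν hνb hind hYb (t := t)
    (by rw [abs_of_pos ht0, htb]; linarith) s (half_pos hδ)
  have hchL := fun s => measure_sum_sq_gt_le hd hYm hYν hνb hind hYb (t := -t)
    (by rw [abs_neg, abs_of_pos ht0, htb]; linarith) s (half_pos hδ)
  rw [hlogη] at hchU hchL
  simp only [neg_mul, htb] at hchU hchL
  set D₀ := d + Real.log (1 / δ) with hD₀
  have hD₀0 : 0 < D₀ := by linarith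
  obtain ⟨τ, hτ⟩ : ∃ τ : ℝ, τ = 4 * M ^ 2 * (max (m : ℝ) D₀ / n) ^ (-(2 / k)) := ⟨_, rfl⟩
  -- The first and third entries enforce `l τ ≤ 1` and `l b² ≤ d`; the middle one balances `l M⁴`
  -- against `(D₀ / n) / l`.
  obtain ⟨l, hl⟩ : ∃ l : ℝ, l = min (1 / τ) (min (√(D₀ / n) / M ^ 2) (d / b ^ 2)) := ⟨_, rfl⟩
  have hD : 0 < max (m : ℝ) D₀ := hD₀0.trans_le (le_max_right _ _)
  have hτ0 : 0 < τ := by rw [hτ]; positivity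
  have hw0 : 0 < √(D₀ / n) := Real.sqrt_pos.2 (by positivity)
  have hl0 : 0 < l := by
    rw [hl]; exact lt_min (by positivity) (lt_min (by positivity) (by positivity))
  have hlτ : l * τ ≤ 1 := by
    rw [← le_div_iff₀ hτ0, hl]; exact min_le_left _ _
  have hlb : l * b ^ 2 ≤ d := by
    rw [← le_div_iff₀ (by positivity), hl]
    exact (min_le_right _ _).trans (min_le_right _ _)
  have hpac := measure_sum_min_lt_le hd hYm hYν hνb hind hYb hk hM hl0 hτ0 hlτ hlb hδ hmom hmom4
  have hU1 := hchU (half₁ n)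
  have hU2 := hchU (half₂ n)
  have hL1 := hchL (half₁ n)
  have hL2' := hchL (half₂ n)
  set U1 := {ω | ¬ ∀ v : E d, t * ∑ i ∈ half₁ n, inner ℝ v (Y i ω) ^ 2 ≤ _}
  set U2 := {ω | ¬ ∀ v : E d, t * ∑ i ∈ half₂ n, inner ℝ v (Y i ω) ^ 2 ≤ _}
  set L1 := {ω | ¬ ∀ v : E d, -(t * ∑ i ∈ half₁ n, inner ℝ v (Y i ω) ^ 2) ≤ _}
  set L2 := {ω | ¬ ∀ v : E d, -(t * ∑ i ∈ half₂ n, inner ℝ v (Y i ω) ^ 2) ≤ _}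
  set PB := {ω | ¬ ∀ v : E d, ‖v‖ ≤ 1 → _}
  have hunion : μ.real (U1 ∪ U2 ∪ (L1 ∪ L2) ∪ PB) ≤ 3 * δ := by
    have a1 := measureReal_union_le (μ := μ) U1 U2
    have a2 := measureReal_union_le (μ := μ) L1 L2
    have a3 := measureReal_union_le (μ := μ) (U1 ∪ U2) (L1 ∪ L2)
    have a4 := measureReal_union_le (μ := μ) (U1 ∪ U2 ∪ (L1 ∪ L2)) PB
    linarith
  refine le_trans (measureReal_mono fun ω hω => ?_) hunion
  by_contra hcon
  simp only [Set.mem_union, not_or] at hcon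
  obtain ⟨⟨⟨u1, u2⟩, l1, l2⟩, pb⟩ := hcon
  replace u1 := not_not.1 u1
  replace u2 := not_not.1 u2
  replace l1 := not_not.1 l1
  replace l2 := not_not.1 l2
  replace pb := not_not.1 pb
  refine hω fun v hv1 hv2 => ?_
  have hunit : ∀ u : E d, ‖u‖ = 1 → 2 / 3 ≤ ∫ y, inner ℝ u y ^ 2 ∂ν →
      ∫ y, inner ℝ u y ^ 2 ∂ν ≤ 1 →
      ResilientAt (fun i => Y i ω) m (100 * rate d n m k M b δ) u := by
    intro u hu hq1 hq2
    set q := ∫ y, inner ℝ u y ^ 2 ∂ν with hq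
    have hub : ∀ s : Finset (Fin n), s = half₁ n ∨ s = half₂ n →
        ∑ i ∈ s, inner ℝ u (Y i ω) ^ 2 ≤ s.card * (1 + 2 * e) * q + n * e := by
      intro s hs
      refine chernoff_upper_le (Nat.cast_nonneg _) (by linarith) he0.le (by linarith) ht0 hLt ?_
      have := hs.elim (fun h => h ▸ u1 u) (fun h => h ▸ u2 u)
      rwa [hu, one_pow, mul_one] at this
    have hlb : ∀ s : Finset (Fin n), s = half₁ n ∨ s = half₂ n →
        s.card * (1 - e) * q - n * e ≤ ∑ i ∈ s, inner ℝ u (Y i ω) ^ 2 := by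
      intro s hs
      refine chernoff_lower_le (Nat.cast_nonneg _) (by linarith) he0.le ht0 hLt ?_
      have := hs.elim (fun h => h ▸ l1 u) (fun h => h ▸ l2 u)
      rw [hu, one_pow, mul_one] at this
      rwa [neg_mul]
    have hc₁ := half_card_bounds hn100 (.inl rfl : half₁ n = half₁ n ∨ _)
    have hc₂ := half_card_bounds hn100 (.inr rfl : _ ∨ half₂ n = half₂ n)
    have hsum := sum_half₁_add_sum_half₂ fun i => (inner ℝ u (Y i ω) : ℝ) ^ 2
    have hcard : ((half₁ n).card : ℝ) + (half₂ n).card = n := by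
      rw [card_half₁, card_half₂]
      have := Nat.div_le_self n 2
      push_cast [Nat.cast_sub this]
      ring
    have hall : ∑ i, inner ℝ u (Y i ω) ^ 2 ≤ n * (1 + 2 * e) * q + 2 * (n * e) := by
      rw [← hsum, ← hcard]
      have a1 := hub _ (.inl rfl)
      have a2 := hub _ (.inr rfl)
      rw [← hcard] at a1 a2
      linarith
    intro H hH
    refine ⟨?_, fun T hTH hT => ?_⟩
    · rcases hH with rfl | rfl
      · rw [← hsum]
        exact half_le_three_quarters hn0.le he0.le he20 hq1 hc₁.2 hc₂.1 (hub _ (.inl rfl))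
          (hlb _ (.inr rfl))
      · rw [← hsum, add_comm]
        exact half_le_three_quarters hn0.le he0.le he20 hq1 hc₂.2 hc₁.1 (hub _ (.inr rfl))
          (hlb _ (.inl rfl))
    · exact sum_subset_le_rate_mul (x := fun i => (inner ℝ u (Y i ω) : ℝ) ^ 2) hd hk hM0 hb hδ
        hδ' hn hT hq2 he hτ hl hall (pb u hu.le)
        (quarter_le_half hn0.le he20 hq1 (half_card_bounds hn100 hH).1 (hlb H hH))
  rcases eq_or_ne v 0 with rfl | hv
  · exact hzero ω
  · have hv0 : 0 < ‖v‖ := norm_pos_iff.2 hv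
    have hq : ∫ y, inner ℝ (‖v‖⁻¹ • v) y ^ 2 ∂ν = (∫ y, inner ℝ v y ^ 2 ∂ν) / ‖v‖ ^ 2 := by
      simp only [real_inner_smul_left, mul_pow]
      rw [integral_const_mul, inv_pow, inv_mul_eq_div]
    have hu := (hunit (‖v‖⁻¹ • v)
      (by rw [norm_smul, norm_inv, norm_norm, inv_mul_cancel₀ hv0.ne'])
      (by rw [hq, le_div_iff₀ (by positivity)]; exact hv1)
      (by rw [hq, div_le_one (by positivity)]; exact hv2)).smul ‖v‖
    rwa [smul_smul, mul_inv_cancel₀ hv0.ne', one_smul] at hu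

end Core

end HeavyTail

namespace HeavyTail

open Matrix

/-! ### Whitening with a singular second moment, and the effect of clipping -/

section Whitening

variable {d : ℕ}

lemma cfc_mul_cfc (S : Matrix (Fin d) (Fin d) ℝ) (f g : ℝ → ℝ) :
    cfc f S * cfc g S = cfc (fun x => f x * g x) S :=
  (cfc_mul f g S (finite_real_spectrum.continuousOn f) (finite_real_spectrum.continuousOn g)).symm

lemma transpose_cfc (S : Matrix (Fin d) (Fin d) ℝ) (f : ℝ → ℝ) : (cfc f S)ᵀ = cfc f S := by
  have h : IsSelfAdjoint (cfc f S) := cfc_predicate f S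
  have := h.star_eq
  rwa [star_eq_conjTranspose, conjTranspose_eq_transpose_of_trivial] at this

/-- The square root `S^{1/2}`. -/
def sqrtMat (S : Matrix (Fin d) (Fin d) ℝ) : Matrix (Fin d) (Fin d) ℝ := cfc (fun x : ℝ => √x) S

lemma sqrtMat_mul_pinvSqrt_mul_self {S : Matrix (Fin d) (Fin d) ℝ} (hS : S.IsHermitian) :
    sqrtMat S * pinvSqrt S * S * (pinvSqrt S * sqrtMat S) = sqrtMat S * sqrtMat S := by
  have hid : cfc (fun x : ℝ => x) S = S := cfc_id' ℝ S hS
  conv_lhs => enter [1, 2]; rw [← hid]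
  simp only [sqrtMat, pinvSqrt, cfc_mul_cfc]
  refine cfc_congr fun x _ => ?_
  rcases le_or_gt x 0 with h | h
  · simp [Real.sqrt_eq_zero_of_nonpos h]
  · have h1 := Real.sqrt_pos.2 h
    have h2 := Real.mul_self_sqrt h.le
    rw [mul_inv_cancel₀ h1.ne', inv_mul_cancel₀ h1.ne', one_mul, mul_one, h2]

/-- `1 - S^{1/2} S^{†/2}` is the projection onto the kernel of `S`: on the spectrum, `1 - √x (√x)⁻¹`
is the indicator of `x = 0`. -/
lemma one_sub_mul_mul_one_sub_eq_zero {S : Matrix (Fin d) (Fin d) ℝ} (hS : S.PosSemidef) :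
    (1 - sqrtMat S * pinvSqrt S) * S * (1 - sqrtMat S * pinvSqrt S) = 0 := by
  have hid : cfc (fun x : ℝ => x) S = S := cfc_id' ℝ S hS.1
  have hone : cfc (fun _ : ℝ => (1 : ℝ)) S = 1 := cfc_const_one ℝ S hS.1
  have hc : ∀ f : ℝ → ℝ, ContinuousOn f (spectrum ℝ S) := fun f => finite_real_spectrum.continuousOn f
  have h1 : 1 - sqrtMat S * pinvSqrt S = cfc (fun x : ℝ => 1 - √x * (√x)⁻¹) S := by
    rw [cfc_sub _ _ _ (hc _) (hc _), hone, sqrtMat, pinvSqrt, cfc_mul_cfc]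
  rw [h1]
  conv_lhs => enter [1, 2]; rw [← hid]
  rw [cfc_mul_cfc, cfc_mul_cfc, ← cfc_zero ℝ S]
  refine cfc_congr fun x hx => ?_
  have hx0 : 0 ≤ x := (posSemidef_iff_isHermitian_and_spectrum_nonneg.1 hS).2 hx
  simp only [Pi.zero_apply]
  rcases hx0.eq_or_lt with h | h
  · simp [← h]
  · rw [mul_inv_cancel₀ (Real.sqrt_pos.2 h).ne']; simp

lemma inner_toLp (u : Fin d → ℝ) (z : E d) : inner ℝ (WithLp.toLp 2 u) z = u ⬝ᵥ z.ofLp := by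
  simp [PiLp.inner_apply, dotProduct, mul_comm]

lemma inner_eq_dotProduct (u z : E d) : inner ℝ u z = u.ofLp ⬝ᵥ z.ofLp := inner_toLp u.ofLp z

lemma inner_whiten (S : Matrix (Fin d) (Fin d) ℝ) (v z : E d) :
    inner ℝ v (whiten S z) = inner ℝ (whiten S v) z := by
  rw [whiten, whiten, inner_toLp, inner_eq_dotProduct]
  simp only
  rw [dotProduct_mulVec, ← mulVec_transpose, pinvSqrt, transpose_cfc]

lemma continuous_whiten (S : Matrix (Fin d) (Fin d) ℝ) : Continuous (whiten S) := by
  unfold whiten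
  fun_prop

variable {P : Measure (E d)}

lemma integrable_coord_mul_coord (hP : MemLp (fun z : E d => z) 2 P) (i j : Fin d) :
    Integrable (fun z : E d => z i * z j) P := by
  have h : ∀ i, MemLp (fun z : E d => z i) 2 P := fun i =>
    hP.mono (Continuous.aestronglyMeasurable (by fun_prop))
      (.of_forall fun z => PiLp.norm_apply_le z i)
  exact (h i).integrable_mul (h j)

lemma integrable_inner_sq (hP : MemLp (fun z : E d => z) 2 P) (w : E d) :
    Integrable (fun z : E d => inner ℝ w z ^ 2) P := by
  have h : MemLp (fun z : E d => inner ℝ w z) 2 P := hP.const_inner w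
  exact h.integrable_sq

lemma posSemidef_secondMoment (hP : MemLp (fun z : E d => z) 2 P) :
    (secondMoment P).PosSemidef := by
  refine .of_dotProduct_mulVec_nonneg (isHermitian_secondMoment P) fun x => ?_
  have := dotProduct_secondMoment_mulVec (integrable_coord_mul_coord hP) (WithLp.toLp 2 x)
  simp only at this
  rw [star_trivial, this]
  exact integral_nonneg fun z => sq_nonneg _

/-- In the range of `S^{1/2}` the whitened vector is isotropic. -/
lemma integral_inner_whiten_sq (hP : MemLp (fun z : E d => z) 2 P) (u : Fin d → ℝ) :
    ∫ z, inner ℝ (WithLp.toLp 2 (sqrtMat (secondMoment P) *ᵥ u))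
        (whiten (secondMoment P) z) ^ 2 ∂P =
      ‖(WithLp.toLp 2 (sqrtMat (secondMoment P) *ᵥ u) : E d)‖ ^ 2 := by
  set S := secondMoment P with hS
  have hSh : S.IsHermitian := isHermitian_secondMoment P
  simp only [inner_whiten]
  rw [← dotProduct_secondMoment_mulVec (integrable_coord_mul_coord hP), ← hS,
    ← real_inner_self_eq_norm_sq, inner_toLp]
  simp only [whiten]
  have t1 : ∀ x : Fin d → ℝ, ∀ A : Matrix (Fin d) (Fin d) ℝ,
      (pinvSqrt S *ᵥ (sqrtMat S *ᵥ x)) ⬝ᵥ (A *ᵥ (pinvSqrt S *ᵥ (sqrtMat S *ᵥ x))) =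
        x ⬝ᵥ ((sqrtMat S * pinvSqrt S * A * (pinvSqrt S * sqrtMat S)) *ᵥ x) := fun x A => by
    rw [dotProduct_comm, dotProduct_mulVec, ← mulVec_transpose, pinvSqrt, transpose_cfc,
      dotProduct_mulVec, ← mulVec_transpose, sqrtMat, transpose_cfc, dotProduct_comm]
    simp only [mulVec_mulVec, Matrix.mul_assoc]
  rw [t1, sqrtMat_mul_pinvSqrt_mul_self hSh, ← mulVec_mulVec, dotProduct_mulVec,
    ← mulVec_transpose]
  simp only [sqrtMat, transpose_cfc]

/-- The component of `Z` in the kernel of `Σ` has zero second moment, so it vanishes almost surely.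
Hence whitening is almost surely invertible even for singular `Σ`. -/
lemma ae_sqrtMat_mulVec_whiten (hP : MemLp (fun z : E d => z) 2 P) :
    ∀ᵐ z ∂P, sqrtMat (secondMoment P) *ᵥ (whiten (secondMoment P) z).ofLp = z.ofLp := by
  set S := secondMoment P with hS
  set A := 1 - sqrtMat S * pinvSqrt S with hA
  have hAt : Aᵀ = A := by
    rw [hA, transpose_sub, transpose_one, sqrtMat, pinvSqrt, cfc_mul_cfc, transpose_cfc]
  have h0 : ∀ i, ∀ᵐ z ∂P, (A *ᵥ z.ofLp) i = 0 := fun i => by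
    have h1 := dotProduct_secondMoment_mulVec (integrable_coord_mul_coord hP)
      (WithLp.toLp 2 (A *ᵥ Pi.single i 1))
    simp only at h1
    rw [← hS, dotProduct_comm, dotProduct_mulVec, ← mulVec_transpose, hAt, mulVec_mulVec,
      mulVec_mulVec, one_sub_mul_mul_one_sub_eq_zero
      (posSemidef_secondMoment hP), zero_mulVec, zero_dotProduct] at h1
    rw [eq_comm, integral_eq_zero_iff_of_nonneg (fun z => sq_nonneg _)
      (integrable_inner_sq hP _)] at h1
    filter_upwards [h1] with z hz
    have h2 : inner ℝ (WithLp.toLp 2 (A *ᵥ Pi.single i 1)) z = 0 := by simpa using hz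
    rw [inner_toLp, dotProduct_comm, dotProduct_mulVec, ← mulVec_transpose, hAt] at h2
    simpa using h2
  filter_upwards [ae_all_iff.2 h0] with z hz
  have h3 : A *ᵥ z.ofLp = 0 := funext hz
  rw [hA, sub_mulVec, one_mulVec, sub_eq_zero, ← mulVec_mulVec] at h3
  exact h3.symm

/-- A moment bound in terms of `eLpNorm`, written with integrals. -/
lemma integral_abs_rpow_le_of_eLpNorm_le {α : Type*} [MeasurableSpace α] {ρ : Measure α}
    {f : α → ℝ} (hf : AEStronglyMeasurable f ρ) {p M : ℝ} (hp : 0 < p) (hM : 0 ≤ M)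
    (h : eLpNorm f (ENNReal.ofReal p) ρ ≤ ENNReal.ofReal M) :
    Integrable (fun x => |f x| ^ p) ρ ∧ ∫ x, |f x| ^ p ∂ρ ≤ M ^ p := by
  have hL : MemLp f (ENNReal.ofReal p) ρ := ⟨hf, h.trans_lt ENNReal.ofReal_lt_top⟩
  have hp0 : ENNReal.ofReal p ≠ 0 := by simpa using hp
  have hI := (integrable_norm_rpow_iff hf hp0 ENNReal.ofReal_ne_top).2 hL
  rw [hL.eLpNorm_eq_integral_rpow_norm hp0 ENNReal.ofReal_ne_top,
    ENNReal.ofReal_le_ofReal_iff hM] at h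
  rw [ENNReal.toReal_ofReal hp.le] at hI h
  simp only [Real.norm_eq_abs] at hI h
  refine ⟨hI, ?_⟩
  have h0 : 0 ≤ ∫ x, |f x| ^ p ∂ρ := integral_nonneg fun x => by positivity
  have h1 := Real.rpow_le_rpow (by positivity) h hp.le
  rwa [← Real.rpow_mul h0, inv_mul_cancel₀ hp.ne', Real.rpow_one] at h1

variable [IsProbabilityMeasure P] {k M b : ℝ}

omit [IsProbabilityMeasure P] in
lemma eLpNorm_inner_whiten_le (hmom : MomentBound P k M) (w : E d) :
    eLpNorm (fun z => inner ℝ w (whiten (secondMoment P) z)) (ENNReal.ofReal k) P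
      ≤ ENNReal.ofReal (M * ‖w‖) := by
  rcases eq_or_ne w 0 with rfl | hw
  · simp
  · have hw0 : 0 < ‖w‖ := norm_pos_iff.2 hw
    have h1 := hmom (‖w‖⁻¹ • w) (by rw [norm_smul, norm_inv, norm_norm, inv_mul_cancel₀ hw0.ne'])
    have h2 : (fun z => (inner ℝ w (whiten (secondMoment P) z) : ℝ)) =
        ‖w‖ • fun z => inner ℝ (‖w‖⁻¹ • w) (whiten (secondMoment P) z) := by
      ext z
      simp only [Pi.smul_apply, smul_eq_mul, real_inner_smul_left]
      rw [← mul_assoc, mul_inv_cancel₀ hw0.ne', one_mul]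
    rw [h2, eLpNorm_const_smul, mul_comm M, ENNReal.ofReal_mul hw0.le]
    refine mul_le_mul' ?_ h1
    rw [enorm_norm, ← ofReal_norm]

variable {clip : E d → E d}

lemma IsClipping.exists_smul {S : Matrix (Fin d) (Fin d) ℝ} (h : IsClipping S b clip) (z : E d) :
    ∃ t : ℝ, 0 ≤ t ∧ t ≤ 1 ∧ clip z = t • z := by
  rcases le_or_gt (mnorm S z) b with hz | hz
  · exact ⟨1, zero_le_one, le_rfl, by rw [h.2.1 z hz, one_smul]⟩
  · obtain ⟨t, h0, h1, h2, -⟩ := h.2.2 z hz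
    exact ⟨t, h0, h1, h2⟩

lemma IsClipping.norm_whiten_le {S : Matrix (Fin d) (Fin d) ℝ} (h : IsClipping S b clip)
    (z : E d) : ‖whiten S (clip z)‖ ≤ b := by
  rcases le_or_gt (mnorm S z) b with hz | hz
  · rw [h.2.1 z hz]; exact hz
  · obtain ⟨t, h0, h1, h2, h3⟩ := h.2.2 z hz
    exact h3

lemma whiten_smul (S : Matrix (Fin d) (Fin d) ℝ) (t : ℝ) (z : E d) :
    whiten S (t • z) = t • whiten S z := by
  ext i
  simp [whiten, mulVec_smul]

lemma IsClipping.abs_inner_whiten_le {S : Matrix (Fin d) (Fin d) ℝ} (h : IsClipping S b clip)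
    (w z : E d) : |inner ℝ w (whiten S (clip z))| ≤ |inner ℝ w (whiten S z)| := by
  obtain ⟨t, h0, h1, h2⟩ := h.exists_smul z
  rw [h2, whiten_smul, real_inner_smul_right, abs_mul, abs_of_nonneg h0]
  exact mul_le_of_le_one_left (abs_nonneg _) h1

lemma IsClipping.measurable_whiten_clip {S : Matrix (Fin d) (Fin d) ℝ} (h : IsClipping S b clip) :
    Measurable fun z => whiten S (clip z) :=
  (continuous_whiten S).measurable.comp h.1

/-- Clipping shrinks every projection pointwise, and `L^p` norms increase with `p` on a probability
space. It serves for `p = k` and `p = 4`. -/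
lemma integral_clipped_abs_rpow_le (hmom : MomentBound P k M) (hM : 0 ≤ M)
    (hclip : IsClipping (secondMoment P) b clip) {p : ℝ} (hp : 0 < p) (hpk : p ≤ k) (w : E d) :
    ∫ z, |inner ℝ w (whiten (secondMoment P) (clip z))| ^ p ∂P ≤ (M * ‖w‖) ^ p := by
  have hf : AEStronglyMeasurable (fun z => (inner ℝ w (whiten (secondMoment P) (clip z)) : ℝ)) P :=
    (((continuous_const (y := w)).inner continuous_id).measurable.comp
      hclip.measurable_whiten_clip).aestronglyMeasurable
  refine (integral_abs_rpow_le_of_eLpNorm_le hf hp (by positivity) ?_).2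
  refine (eLpNorm_le_eLpNorm_of_exponent_le (ENNReal.ofReal_le_ofReal hpk) hf).trans ?_
  refine le_trans (eLpNorm_mono fun z => ?_) (eLpNorm_inner_whiten_le hmom w)
  simpa using hclip.abs_inner_whiten_le w z

/-- The part of the second moment that clipping may remove. -/
lemma setIntegral_inner_whiten_sq_le (hmom : MomentBound P k M) (hM : 0 ≤ M) (hk : 4 ≤ k)
    (w : E d) {s : Set (E d)} :
    ∫ z in s, inner ℝ w (whiten (secondMoment P) z) ^ 2 ∂P ≤
      M ^ 2 * P.real s ^ (1 - 2 / k) * ‖w‖ ^ 2 := by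
  have hf : AEStronglyMeasurable (fun z => (inner ℝ w (whiten (secondMoment P) z) : ℝ))
      (P.restrict s) :=
    ((continuous_const (y := w)).inner (continuous_whiten _)).aestronglyMeasurable
  have h1 := eLpNorm_le_eLpNorm_mul_rpow_measure_univ
    (ENNReal.ofReal_le_ofReal (by linarith : (2 : ℝ) ≤ k)) hf
  have h2 : eLpNorm (fun z => (inner ℝ w (whiten (secondMoment P) z) : ℝ)) (ENNReal.ofReal 2)
      (P.restrict s) ≤ ENNReal.ofReal (M * ‖w‖ * P.real s ^ (1 / 2 - 1 / k)) := by
    refine h1.trans ?_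
    rw [ENNReal.ofReal_mul (by positivity), Measure.restrict_apply_univ,
      ENNReal.toReal_ofReal zero_le_two, ENNReal.toReal_ofReal (by linarith)]
    refine mul_le_mul' ((eLpNorm_mono_measure _ Measure.restrict_le_self).trans
      (eLpNorm_inner_whiten_le hmom w)) ?_
    have he : 0 ≤ 1 / 2 - 1 / k := by
      rw [sub_nonneg]; exact one_div_le_one_div_of_le two_pos (by linarith)
    rw [← ENNReal.ofReal_rpow_of_nonneg measureReal_nonneg he, ofReal_measureReal]
  have h3 := (integral_abs_rpow_le_of_eLpNorm_le hf two_pos (by positivity) h2).2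
  simp only [Real.rpow_two, sq_abs] at h3
  refine h3.trans_eq ?_
  rw [mul_pow, mul_pow, ← Real.rpow_natCast (P.real s ^ _) 2, ← Real.rpow_mul measureReal_nonneg]
  rw [show (1 / 2 - 1 / k) * ((2 : ℕ) : ℝ) = 1 - 2 / k by push_cast; ring]
  ring

/-- Off the clipping event nothing changes. On it, Hölder's inequality bounds the loss by `M²
ℙ(‖Z‖_Σ > b)^(1-2/k) ‖v‖²`, at most `‖v‖² / 3` by the rarity assumption. -/
lemma clipped_second_moment_bounds (hP : MemLp (fun z : E d => z) 2 P)
    (hmom : MomentBound P k M) (hM : 0 ≤ M) (hk : 4 ≤ k)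
    (hrare : 3 * M ^ 2 * P.real {z | b < mnorm (secondMoment P) z} ^ (1 - 2 / k) ≤ 1)
    (hclip : IsClipping (secondMoment P) b clip) {v : E d}
    (hv : ∫ z, inner ℝ v (whiten (secondMoment P) z) ^ 2 ∂P = ‖v‖ ^ 2) :
    2 / 3 * ‖v‖ ^ 2 ≤ ∫ z, inner ℝ v (whiten (secondMoment P) (clip z)) ^ 2 ∂P ∧
      ∫ z, inner ℝ v (whiten (secondMoment P) (clip z)) ^ 2 ∂P ≤ ‖v‖ ^ 2 := by
  set S := secondMoment P with hS
  have hI : Integrable (fun z => inner ℝ v (whiten S z) ^ 2) P := by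
    simp only [inner_whiten]; exact integrable_inner_sq hP _
  have hle : ∀ z, inner ℝ v (whiten S (clip z)) ^ 2 ≤ inner ℝ v (whiten S z) ^ 2 := fun z =>
    sq_le_sq.2 (hclip.abs_inner_whiten_le v z)
  have hm : Measurable fun z => (inner ℝ v (whiten S (clip z)) : ℝ) ^ 2 :=
    (((continuous_const (y := v)).inner continuous_id).measurable.comp
      hclip.measurable_whiten_clip).pow_const 2
  have hIc : Integrable (fun z => inner ℝ v (whiten S (clip z)) ^ 2) P :=
    hI.mono hm.aestronglyMeasurable (.of_forall fun z => by simpa using hle z)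
  refine ⟨?_, (integral_mono hIc hI hle).trans_eq hv⟩
  set s := {z | b < mnorm S z} with hs
  have hsm : MeasurableSet s := measurableSet_lt measurable_const (continuous_mnorm S).measurable
  have h1 := setIntegral_inner_whiten_sq_le hmom hM hk v (s := s)
  have h2 := integral_add_compl hsm hI
  have h3 : ∫ z in sᶜ, inner ℝ v (whiten S z) ^ 2 ∂P ≤
      ∫ z, inner ℝ v (whiten S (clip z)) ^ 2 ∂P := by
    have h4 : ∫ z in sᶜ, inner ℝ v (whiten S z) ^ 2 ∂P =
        ∫ z in sᶜ, inner ℝ v (whiten S (clip z)) ^ 2 ∂P := by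
      refine setIntegral_congr_fun hsm.compl fun z hz => ?_
      simp only [hs, Set.mem_compl_iff, Set.mem_ofPred_eq, not_lt] at hz
      simp only [hclip.2.1 z hz]
    rw [h4]
    exact setIntegral_le_integral hIc (.of_forall fun z => sq_nonneg _)
  rw [hv] at h2
  have h5 := mul_le_mul_of_nonneg_right hrare (sq_nonneg ‖v‖)
  rw [← hS] at h1
  linarith

end Whitening

/-! ### Return to the original coordinates -/

section Main

variable {n d : ℕ}

lemma dotProduct_scov_mulVec (z : Fin n → E d) (I : Finset (Fin n)) (u : Fin d → ℝ) :
    u ⬝ᵥ (scov z I *ᵥ u) = 1 / n * ∑ i ∈ I, (u ⬝ᵥ (z i).ofLp) ^ 2 := by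
  rw [scov, smul_mulVec, dotProduct_smul, sum_mulVec, dotProduct_sum, smul_eq_mul]
  congr 1
  refine Finset.sum_congr rfl fun i _ => ?_
  rw [vecMulVec_mulVec, dotProduct_smul, op_smul_eq_smul, smul_eq_mul,
    dotProduct_comm (z i).ofLp, sq]

lemma isHermitian_scov (z : Fin n → E d) (I : Finset (Fin n)) : (scov z I).IsHermitian := by
  ext i j
  simp [scov, Matrix.sum_apply, vecMulVec_apply, mul_comm]

lemma posSemidef_smul_scov_sub {z : Fin n → E d} {I J : Finset (Fin n)} {c : ℝ}
    (h : ∀ u : Fin d → ℝ, ∑ i ∈ J, (u ⬝ᵥ (z i).ofLp) ^ 2 ≤ c * ∑ i ∈ I, (u ⬝ᵥ (z i).ofLp) ^ 2) :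
    (c • scov z I - scov z J).PosSemidef := by
  refine .of_dotProduct_mulVec_nonneg ?_ fun u => ?_
  · ext i j
    simp [← (isHermitian_scov z I).apply i j, ← (isHermitian_scov z J).apply i j]
  · rw [star_trivial, sub_mulVec, smul_mulVec, dotProduct_sub, dotProduct_smul,
      dotProduct_scov_mulVec, dotProduct_scov_mulVec, smul_eq_mul]
    have : (0 : ℝ) ≤ 1 / n := by positivity
    nlinarith [mul_le_mul_of_nonneg_left (h u) this]

/-- Heavy-tailed operator norm resilience with the constants `400` and `100`. -/
lemma le_measure_opNormResilient (hd : 1 ≤ d) {k M b δ : ℝ} (hk : 4 ≤ k) (hM : 0 ≤ M)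
    (hb : 0 < b) (hδ : 0 < δ) {P : Measure (E d)} [IsProbabilityMeasure P]
    (hP : MemLp (fun z : E d => z) 2 P) (hmom : MomentBound P k M)
    (hrare : 3 * M ^ 2 * P.real {z | b < mnorm (secondMoment P) z} ^ (1 - 2 / k) ≤ 1)
    {clip : E d → E d} (hclip : IsClipping (secondMoment P) b clip) {m : ℕ}
    (hn : 400 * (b ^ 2 * Real.log (2 * d / δ)) ≤ n) {Ω : Type*} [MeasurableSpace Ω]
    {μ : Measure Ω} [IsProbabilityMeasure μ] {Z : Fin n → Ω → E d}
    (hZm : ∀ i, Measurable (Z i)) (hZP : ∀ i, μ.map (Z i) = P) (hind : iIndepFun Z μ) :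
    1 - 4 * δ ≤ μ.real {ω | OpNormResilient (fun i => clip (Z i ω)) m
      (100 * rate d n m k M b δ)} := by
  -- For `δ ≥ 1/4` the claimed probability is not positive.
  rcases le_or_gt (1 / 4) δ with hδ4 | hδ4
  · exact le_trans (by linarith) measureReal_nonneg
  set S := secondMoment P with hS
  have hg : Measurable fun z => whiten S (clip z) := hclip.measurable_whiten_clip
  set Y : Fin n → Ω → E d := fun i ω => whiten S (clip (Z i ω)) with hY
  set ν : Measure (E d) := P.map fun z => whiten S (clip z) with hν
  have hνp : IsProbabilityMeasure ν := Measure.isProbabilityMeasure_map hg.aemeasurable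
  have hYm : ∀ i, Measurable (Y i) := fun i => hg.comp (hZm i)
  have hYν : ∀ i, μ.map (Y i) = ν := fun i => by
    rw [hν, ← hZP i, Measure.map_map hg (hZm i)]; rfl
  have hYind : iIndepFun Y μ := hind.comp (fun _ z => whiten S (clip z)) fun _ => hg
  have hYb : ∀ i ω, ‖Y i ω‖ ≤ b := fun i ω => hclip.norm_whiten_le _
  have hνb : ∀ᵐ y ∂ν, ‖y‖ ≤ b := by
    rw [hν, ae_map_iff hg.aemeasurable (measurableSet_le measurable_norm measurable_const)]
    exact .of_forall fun z => hclip.norm_whiten_le z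
  have hνint : ∀ {f : E d → ℝ}, Measurable f → ∫ y, f y ∂ν = ∫ z, f (whiten S (clip z)) ∂P :=
    fun hf => integral_map hg.aemeasurable hf.aestronglyMeasurable
  have hcore := measure_not_resilientAt_le (m := m) hd hk hM hb hδ hδ4 hn hYm hYν hνb hYind hYb
    (fun w => by
      rw [hνint (by fun_prop)]
      exact integral_clipped_abs_rpow_le hmom hM hclip (by linarith) le_rfl w)
    (fun w => by
      rw [hνint (by fun_prop)]
      have := integral_clipped_abs_rpow_le hmom hM hclip (by norm_num : (0 : ℝ) < 4) hk w
      rw [← hS] at this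
      have h4 : ∀ x : ℝ, |x| ^ (4 : ℝ) = x ^ 4 := fun x => by
        rw [show (4 : ℝ) = ((4 : ℕ) : ℝ) by norm_num, Real.rpow_natCast]
        exact (by decide : Even 4).pow_abs x
      rw [← abs_of_nonneg (by positivity : 0 ≤ M * ‖w‖), h4] at this
      simpa only [h4] using this)
  have hnull : μ.real {ω | ¬ ∀ i, sqrtMat S *ᵥ (whiten S (Z i ω)).ofLp = (Z i ω).ofLp} = 0 := by
    have h : ∀ᵐ ω ∂μ, ∀ i, sqrtMat S *ᵥ (whiten S (Z i ω)).ofLp = (Z i ω).ofLp := by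
      refine ae_all_iff.2 fun i => ?_
      have h1 := ae_sqrtMat_mulVec_whiten hP
      rw [← hZP i] at h1
      have h2 := ae_of_ae_map (hZm i).aemeasurable h1
      rwa [hZP i] at h2
    rw [measureReal_def, ae_iff.1 h, ENNReal.toReal_zero]
  set Bad := {ω | ¬ ∀ v : E d, 2 / 3 * ‖v‖ ^ 2 ≤ ∫ y, inner ℝ v y ^ 2 ∂ν →
      ∫ y, inner ℝ v y ^ 2 ∂ν ≤ ‖v‖ ^ 2 →
      ResilientAt (fun i => Y i ω) m (100 * rate d n m k M b δ) v} with hBad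
  set Null := {ω | ¬ ∀ i, sqrtMat S *ᵥ (whiten S (Z i ω)).ofLp = (Z i ω).ofLp} with hNull
  set Good := {ω | OpNormResilient (fun i => clip (Z i ω)) m (100 * rate d n m k M b δ)} with hGood
  -- Covering the whole space and using subadditivity avoids any measurability of the good event.
  have hcover : (Set.univ : Set Ω) ⊆ Good ∪ (Bad ∪ Null) := by
    intro ω _
    by_contra hcon
    simp only [Set.mem_union, not_or] at hcon
    obtain ⟨h1, h2, h3⟩ := hcon
    replace h2 := not_not.1 h2
    replace h3 := not_not.1 h3
    have hrange : ∀ i, sqrtMat S *ᵥ (Y i ω).ofLp = (clip (Z i ω)).ofLp := fun i => by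
      obtain ⟨t, -, -, ht⟩ := hclip.exists_smul (Z i ω)
      simp only [hY]
      rw [ht, whiten_smul, WithLp.ofLp_smul, WithLp.ofLp_smul, mulVec_smul, h3 i]
    -- Clipping rescales, so it stays in the range of `S^{1/2}`. Testing the original matrices with
    -- `u` therefore amounts to testing the whitened sample with `S^{1/2} u`, where isotropy holds.
    have hdot : ∀ (u : Fin d → ℝ) i, u ⬝ᵥ (clip (Z i ω)).ofLp =
        inner ℝ (WithLp.toLp 2 (sqrtMat S *ᵥ u)) (Y i ω) := fun u i => by
      rw [inner_toLp, ← hrange i, dotProduct_mulVec, ← mulVec_transpose, sqrtMat, transpose_cfc]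
    have hres : ∀ u : Fin d → ℝ, ResilientAt (fun i => Y i ω) m (100 * rate d n m k M b δ)
        (WithLp.toLp 2 (sqrtMat S *ᵥ u)) := fun u => by
      have hb := clipped_second_moment_bounds hP hmom hM hk hrare hclip
        (integral_inner_whiten_sq hP u)
      refine h2 _ ?_ ?_
      · rw [hνint (by fun_prop)]; exact hb.1
      · rw [hνint (by fun_prop)]; exact hb.2
    refine h1 fun H hH => ⟨posSemidef_smul_scov_sub fun u => ?_,
      fun T hTH hT => posSemidef_smul_scov_sub fun u => ?_⟩
    · simp only [hdot]
      exact (hres u H hH).1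
    · simp only [hdot]
      exact (hres u H hH).2 T hTH hT
  have e1 := measureReal_mono (μ := μ) hcover
  have e2 := measureReal_union_le (μ := μ) Good (Bad ∪ Null)
  have e3 := measureReal_union_le (μ := μ) Bad Null
  rw [probReal_univ] at e1
  linarith

end Main

end HeavyTail

end

theorem mainTheorem2 :
    ∃ C₀ C : ℝ, 0 < C₀ ∧ 0 < C ∧
      ∀ (d : ℕ), 1 ≤ d →
      ∀ (k M b δ : ℝ), 4 ≤ k → 0 ≤ M → 0 < b → 0 < δ → δ < 1 →
      ∀ (P : Measure (HeavyTail.E d)), IsProbabilityMeasure P →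
        MemLp (fun z : HeavyTail.E d => z) 2 P →
        HeavyTail.MomentBound P k M →
        3 * M ^ 2 *
          P.real {z | b < HeavyTail.mnorm (HeavyTail.secondMoment P) z} ^ (1 - 2 / k) ≤ 1 →
      ∀ (clip : HeavyTail.E d → HeavyTail.E d),
        HeavyTail.IsClipping (HeavyTail.secondMoment P) b clip →
      ∀ (n m : ℕ), C₀ * (b ^ 2 * Real.log (2 * d / δ)) ≤ n → m ≤ n →
      ∀ (Ω : Type*) (_ : MeasurableSpace Ω) (μ : Measure Ω), IsProbabilityMeasure μ →
      ∀ (Z : Fin n → Ω → HeavyTail.E d),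
        (∀ i, Measurable (Z i)) → (∀ i, μ.map (Z i) = P) → iIndepFun Z μ →
        1 - 4 * δ ≤ μ.real {ω | HeavyTail.OpNormResilient (fun i => clip (Z i ω)) m
          (C * HeavyTail.rate d n m k M b δ)} := by
  refine ⟨400, 100, by norm_num, by norm_num, ?_⟩
  intro d hd k M b δ hk hM hb hδ _ P _ hP hmom hrare clip hclip n m hn _ Ω _ μ _ Z hZm hZP hind
  exact HeavyTail.le_measure_opNormResilient hd hk hM hb hδ hP hmom hrare hclip hn hZm hZP hind
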